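/- Let $\mathcal C$ be a finite set of $m$ candidates. A \emph{partial vote} is a partial order on $\mathcal C$, a \emph{complete vote} is a linear order on $\mathcal C$, and a complete vote $\succ'$ \emph{extends} a partial vote $\succ$ if ${\succ}\subseteq{\succ'}$. An unordered pair of distinct candidates is \emph{undetermined} in a partial vote if the two candidates are incomparable in it. For a profile $(\succ_1,\dots,\succ_n)$ of complete votes and candidates $x\neq y$ let $D(x,y)=|\{i: x\succ_i y\}|-|\{i: y\succ_i x\}|$. For $\alpha\in[0,1]$ the Copeland$^\alpha$ score of $x$ is $|\{y\ne x: D(x,y)>0\}|+\alpha\,|\{y\neq x: D(x,y)=0\}|$, and the (co-)winners are the candidates of maximum score. \textsc{Possible Winner} for Copeland$^\alpha$: given partial votes $p_1,\dots,p_n$ ($n\ge 1$) over $\mathcal C$ and a candidate $c\in\mathcal C$, are there complete votes $\succ_1,\dots,\succ_n$, with $\succ_i$ extending $p_i$ for every $i$, such that $c$ is a (co-)winner of $(\succ_1,\dots,\succ_n)$? An instance is written as a binary string by giving $m$ and $c$ in unary, followed by the $m\times m$ zero-one matrices of the partial votes, one after the other. \textbf{Theorem.} For $\alpha=0$ and for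 $\alpha=1$, the problem \textsc{Possible Winner} for Copeland$^\alpha$, restricted to the instances in which every partial vote has at most $1$ undetermined pair of candidates, is in $\mathsf P$; that is, the set of encodings of the yes-instances with this property is a language decided by a Turing machine in time polynomial in the length of the input. -/

import Mathlib

/-- A partial vote over `m` candidates: a partial order (reflexive, antisymmetric, transitive) on
the candidates, where `pref x y` means that `x` is weakly preferred to `y`. -/
structure PartialVote (m : ℕ) where
  pref : Fin m → Fin m → Prop
  isPartialOrder : IsPartialOrder (Fin m) pref

/-- A (complete) vote over `m` candidates: a linear order on the candidates, where `pref x y`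
means that `x` is weakly preferred to `y`; for `x ≠ y` this says that `x` is placed before `y`. -/
structure CompleteVote (m : ℕ) where
  pref : Fin m → Fin m → Prop
  isLinearOrder : IsLinearOrder (Fin m) pref

/-- The complete vote `v` extends the partial vote `p`. -/
def CompleteVote.Extends {m : ℕ} (v : CompleteVote m) (p : PartialVote m) : Prop :=
  ∀ x y, p.pref x y → v.pref x y

/-- The number of undetermined (unordered) pairs of candidates of a partial vote. Each unordered
pair of distinct candidates is counted once, with its smaller label first. -/
noncomputable def PartialVote.numUndetermined {m : ℕ} (p : PartialVote m) : ℕ :=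
  {q : Fin m × Fin m | q.1 < q.2 ∧ ¬ p.pref q.1 q.2 ∧ ¬ p.pref q.2 q.1}.ncard

/-- A voting rule maps each profile of `n` complete votes over `m`
candidates to its set of (co-)winners. -/
abbrev VotingRule : Type := ∀ n m : ℕ, (Fin n → CompleteVote m) → Set (Fin m)

/-- The margin of `x` from `y` in a profile (used for `x ≠ y`). -/
noncomputable def margin {n m : ℕ} (V : Fin n → CompleteVote m) (x y : Fin m) : ℤ :=
  ({i | (V i).pref x y}.ncard : ℤ) - ({i | (V i).pref y x}.ncard : ℤ)

/-- The Copeland score of `x` with tie parameter `α`. -/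
noncomputable def copelandScore (α : ℝ) {n m : ℕ} (V : Fin n → CompleteVote m) (x : Fin m) : ℝ :=
  ({y | y ≠ x ∧ 0 < margin V x y}.ncard : ℝ) + α * ({y | y ≠ x ∧ margin V x y = 0}.ncard : ℝ)

/-- The Copeland rule with tie parameter `α`: the winners are the candidates of maximum score. -/
def copeland (α : ℝ) : VotingRule :=
  fun _ _ V => {x | ∀ y, copelandScore α V y ≤ copelandScore α V x}

/-- An instance of the Possible Winner problem: `m` candidates, `n ≥ 1` partial votes over them,
and a distinguished candidate. -/
structure PWInstance where
  m : ℕ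
  n : ℕ
  n_pos : 0 < n
  votes : Fin n → PartialVote m
  c : Fin m

/-- `I` is a yes-instance of Possible Winner for the rule `r`: its partial votes can be extended
to complete votes for which `c` is a (co-)winner. -/
def PWInstance.IsYes (r : VotingRule) (I : PWInstance) : Prop :=
  ∃ V : Fin I.n → CompleteVote I.m, (∀ i, (V i).Extends (I.votes i)) ∧ I.c ∈ r I.n I.m V

open Classical in
/-- The binary encoding `1ᵐ 0 1ᶜ 0 A₁ … Aₙ` of an instance, where `Aᵢ` is the `m × m` zero-one
matrix of the `i`-th partial vote, written row by row. -/
noncomputable def PWInstance.encode (I : PWInstance) : List Bool :=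
  List.replicate I.m true ++ false :: (List.replicate I.c true ++ false ::
    (List.finRange I.n).flatMap fun i =>
      (List.finRange I.m).flatMap fun x =>
        (List.finRange I.m).map fun y => decide ((I.votes i).pref x y))

/-- The language of the problem Possible Winner for the rule `r`, restricted to the instances in
which every partial vote has at most `t` undetermined pairs of candidates. -/
def possibleWinner (r : VotingRule) (t : ℕ) : Language Bool :=
  {w | ∃ I : PWInstance, I.encode = w ∧ (∀ i, (I.votes i).numUndetermined ≤ t) ∧ I.IsYes r}

/-- The complexity class P: a language of binary strings is in P if its characteristic function is
computed by a (multi-stack) Turing machine within a number of steps that is polynomial in the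
length of the input. -/
def InP (L : Language Bool) : Prop :=
  ∃ f : List Bool → Bool, (∀ w, f w = true ↔ w ∈ L) ∧
    Nonempty (Turing.TM2ComputableInPolyTime (id : List Bool → List Bool) Computability.encodeBool f)

/-! A partial vote with at most one undetermined pair becomes a linear order whichever way this pair
is ordered (`PartialVote.exists_extension`). Hence the pairs of candidates are independent: the
support of x against y may be any number from the number of votes that fix x before y up to n minus
the number that fix y before x, regardless of the other pairs (`exists_profile`).

It is best for `c` to take its largest possible support against everybody, which makes its score
`goal`. Consider a pair without `c`. Some points may be forced. If no point is forced, α = 0 and n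
is even, the pair can be tied and nobody gets a point. If no point is forced otherwise, at least one
of the two gets a point, and a single point can be given to either of them. So `c` can win iff the
disputed points can be distributed with no total above `goal` (`exists_winning_extension_iff`). This
is a graph orientation problem with a bound on the indegrees.

The orientation problem is decided by fictitious play instead of a flow algorithm
(`distributable_iff`). Every round distributes all points anew, and a disputed point goes to the
candidate with the smaller total so far. If a distribution with bound S exists, a quadratic
potential shows that after T > m^5 rounds all averages are below S + 1/m (`Distributable.play_lt`).
If none exists, Hall's theorem gives a set W of candidates that receives at least |W| S + 1 points
in every round, so some average is at least S + 1/m (`distributable_of_play_lt`).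

For the running time, `PT` is a class of functions on tree-coded data computed by structured stack
programs. It is closed under composition, pairing, size-bounded recursion, counting and tabulation;
predicates in it give languages in P (`inP_of_pt`). Numbers are in unary, which is harmless since
all numbers that occur are polynomially bounded. -/

namespace PolyTime

open Turing Function

/-! ### Trees and four-stack machines -/

/-- Binary trees, the universal data type of the machine model below. -/
inductive Tree
  | leaf
  | node (l r : Tree)

/-- The prefix code of a tree. -/
def Tree.code : Tree → List Bool
  | leaf => [false]
  | node l r => true :: (l.code ++ r.code)

/-- The number of nodes on the right spine of a tree. -/
def Tree.spine : Tree → ℕ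
  | leaf => 0
  | node _ r => r.spine + 1

/-- The stacks of the machines: values live on `main`; the others are scratch space. -/
inductive Reg
  | main | fst | snd | cnt
  deriving DecidableEq

instance : Fintype Reg := ⟨{.main, .fst, .snd, .cnt}, fun k => by cases k <;> decide⟩

/-- Contents of the four stacks. -/
def stk (a b c d : List Bool) : Reg → List Bool
  | .main => a
  | .fst => b
  | .snd => c
  | .cnt => d

section
variable (a b c d x : List Bool)
@[simp] theorem stk_main : stk a b c d .main = a := rfl
@[simp] theorem stk_fst : stk a b c d .fst = b := rfl
@[simp] theorem stk_snd : stk a b c d .snd = c := rfl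
@[simp] theorem stk_cnt : stk a b c d .cnt = d := rfl
@[simp] theorem update_stk_main : update (stk a b c d) .main x = stk x b c d := by
  funext k; cases k <;> rfl
@[simp] theorem update_stk_fst : update (stk a b c d) .fst x = stk a x c d := by
  funext k; cases k <;> rfl
@[simp] theorem update_stk_snd : update (stk a b c d) .snd x = stk a b x d := by
  funext k; cases k <;> rfl
@[simp] theorem update_stk_cnt : update (stk a b c d) .cnt x = stk a b c x := by
  funext k; cases k <;> rfl
end

/-- Statements with labels in `Λ`; the internal state holds at most one bit. -/
abbrev Stm (Λ : Type) : Type := TM2.Stmt (fun _ : Reg => Bool) Λ (Option Bool)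

/-- Relabelling of a statement. -/
def relabel {Λ Λ' : Type} (f : Λ → Λ') : Stm Λ → Stm Λ'
  | .push k g q => .push k g (relabel f q)
  | .peek k g q => .peek k g (relabel f q)
  | .pop k g q => .pop k g (relabel f q)
  | .load g q => .load g (relabel f q)
  | .branch g q₁ q₂ => .branch g (relabel f q₁) (relabel f q₂)
  | .goto g => .goto fun v => f (g v)
  | .halt => .halt

theorem stepAux_relabel {Λ Λ' : Type} (f : Λ → Λ') (q : Stm Λ) (v : Option Bool)
    (S : Reg → List Bool) :
    TM2.stepAux (relabel f q) v S =
      ⟨(TM2.stepAux q v S).l.map f, (TM2.stepAux q v S).var, (TM2.stepAux q v S).stk⟩ := by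
  induction q generalizing v S with
  | branch g q₁ q₂ h₁ h₂ =>
    simp only [relabel, TM2.stepAux]
    cases g v
    · exact h₂ v S
    · exact h₁ v S
  | _ => simp_all [relabel, TM2.stepAux]

/-! ### Structured programs and their running time -/

/-- A program fragment with one entry; jumping to the label `none` leaves the fragment. -/
structure Block where
  Λ : Type
  [fin : Fintype Λ]
  entry : Λ
  code : Λ → Stm (Option Λ)

attribute [instance] Block.fin

/-- `Run M n l v S v' S'`: started at the label `l`, the code `M` exits after `n` steps. -/
inductive Run {Λ : Type} (M : Λ → Stm (Option Λ)) :
    ℕ → Λ → Option Bool → (Reg → List Bool) → Option Bool → (Reg → List Bool) → Prop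
  | exit {l v S v' S'} (h : TM2.stepAux (M l) v S = ⟨some none, v', S'⟩) : Run M 1 l v S v' S'
  | step {n l v S l' v' S' v'' S''} (h : TM2.stepAux (M l) v S = ⟨some (some l'), v', S'⟩)
      (hr : Run M n l' v' S' v'' S'') : Run M (n + 1) l v S v'' S''

/-- The block turns the stacks `S` into `S'` in at most `t` steps, for every internal state. -/
def Block.Sends (B : Block) (t : ℕ) (S S' : Reg → List Bool) : Prop :=
  ∀ v, ∃ n ≤ t, ∃ v', Run B.code n B.entry v S v' S'

theorem Block.Sends.mono {B : Block} {t t' : ℕ} {S S' : Reg → List Bool} (h : B.Sends t S S')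
    (ht : t ≤ t') : B.Sends t' S S' := fun v =>
  let ⟨n, hn, v', hr⟩ := h v
  ⟨n, hn.trans ht, v', hr⟩

/-- All program constructors rest on this. The exit of the fragment is redirected by `e`: either it
remains an exit of the larger program, or it becomes a jump to `x`, and then the run is concatenated
with one that starts at `x`. -/
theorem Run.embed {Λ Λ' : Type} {M : Λ → Stm (Option Λ)} {M' : Λ' → Stm (Option Λ')}
    (f : Λ → Λ') (e : Option Λ → Option Λ') (he : ∀ l, e (some l) = some (f l))
    (hM : ∀ l, M' (f l) = relabel e (M l))
    {n l v S v' S'} (h : Run M n l v S v' S') :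
    (e none = none → Run M' n (f l) v S v' S') ∧
    ∀ x, e none = some x → ∀ {k v'' S''}, Run M' k x v' S' v'' S'' →
      Run M' (n + k) (f l) v S v'' S'' := by
  induction h with
  | exit h =>
    refine ⟨fun h0 => .exit ?_, fun x hx k v'' S'' hr => ?_⟩
    · rw [hM, stepAux_relabel, h, ← h0]; rfl
    · rw [add_comm]
      refine .step ?_ hr
      rw [hM, stepAux_relabel, h, ← hx]; rfl
  | step h _ ih =>
    refine ⟨fun h0 => .step ?_ (ih.1 h0), fun x hx k v'' S'' hr => ?_⟩
    · rw [hM, stepAux_relabel, h, ← he]; rfl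
    · rw [add_right_comm]
      refine .step ?_ (ih.2 x hx hr)
      rw [hM, stepAux_relabel, h, ← he]; rfl

/-- A block that consists of one statement. -/
def op (q : Stm (Option Unit)) : Block := ⟨Unit, (), fun _ => q⟩

theorem op_sends {q : Stm (Option Unit)} {S S' : Reg → List Bool}
    (h : ∀ v, ∃ v', TM2.stepAux q v S = ⟨some none, v', S'⟩) : (op q).Sends 1 S S' := fun v =>
  let ⟨v', hv⟩ := h v
  ⟨1, le_rfl, v', .exit hv⟩

/-- Sequential composition. -/
def seq (B C : Block) : Block where
  Λ := B.Λ ⊕ C.Λ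
  entry := .inl B.entry
  code
    | .inl l => relabel (fun o => some (o.elim (.inr C.entry) .inl)) (B.code l)
    | .inr l => relabel (Option.map .inr) (C.code l)

theorem seq_sends {B C : Block} {t t' : ℕ} {S S' S'' : Reg → List Bool} (h : B.Sends t S S')
    (h' : C.Sends t' S' S'') : (seq B C).Sends (t + t') S S'' := by
  intro v
  obtain ⟨n, hn, v', hr⟩ := h v
  obtain ⟨k, hk, v'', hr'⟩ := h' v'
  refine ⟨n + k, by omega, v'', ?_⟩
  exact (hr.embed (M' := (seq B C).code) Sum.inl _ (fun _ => rfl) (fun _ => rfl)).2 _ rfl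
    ((hr'.embed (M' := (seq B C).code) Sum.inr (Option.map Sum.inr) (fun _ => rfl)
      (fun _ => rfl)).1 rfl)

/-- The loop that executes `B` as long as the top of the stack `k` satisfies `p`. -/
def loop (k : Reg) (p : Option Bool → Bool) (B : Block) : Block where
  Λ := Option B.Λ
  entry := none
  code
    | none => .peek k (fun _ s => s) (.branch p (.goto fun _ => some (some B.entry))
        (.goto fun _ => none))
    | some l => relabel (fun o => some o) (B.code l)

theorem loop_exit {k : Reg} {p : Option Bool → Bool} {B : Block} {S : Reg → List Bool}
    (h : p (S k).head? = false) : (loop k p B).Sends 1 S S := fun v =>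
  ⟨1, le_rfl, (S k).head?, .exit (by simp [loop, h])⟩

theorem loop_step {k : Reg} {p : Option Bool → Bool} {B : Block} {t t' : ℕ}
    {S S' S'' : Reg → List Bool} (h : p (S k).head? = true) (hB : B.Sends t S S')
    (hl : (loop k p B).Sends t' S' S'') : (loop k p B).Sends (t + t' + 1) S S'' := by
  intro v
  obtain ⟨n, hn, v', hr⟩ := hB (S k).head?
  obtain ⟨j, hj, v'', hr'⟩ := hl v'
  refine ⟨n + j + 1, by omega, v'', .step (l' := some B.entry) (v' := (S k).head?) (S' := S)
    (by simp [loop, h]) ?_⟩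
  exact (hr.embed (M' := (loop k p B).code) some (fun o => some o) (fun _ => rfl)
    (fun _ => rfl)).2 _ rfl hr'

/-- The block that executes `B` once if the top of the stack `k` satisfies `p`. -/
def guarded (k : Reg) (p : Option Bool → Bool) (B : Block) : Block where
  Λ := Option B.Λ
  entry := none
  code
    | none => .peek k (fun _ s => s) (.branch p (.goto fun _ => some (some B.entry))
        (.goto fun _ => none))
    | some l => relabel (Option.map some) (B.code l)

theorem guarded_skip {k : Reg} {p : Option Bool → Bool} {B : Block} {S : Reg → List Bool}
    (h : p (S k).head? = false) : (guarded k p B).Sends 1 S S := fun v =>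
  ⟨1, le_rfl, (S k).head?, .exit (by simp [guarded, h])⟩

theorem guarded_run {k : Reg} {p : Option Bool → Bool} {B : Block} {t : ℕ}
    {S S' : Reg → List Bool} (h : p (S k).head? = true) (hB : B.Sends t S S') :
    (guarded k p B).Sends (t + 1) S S' := by
  intro v
  obtain ⟨n, hn, v', hr⟩ := hB (S k).head?
  refine ⟨n + 1, by omega, v', .step (l' := some B.entry) (v' := (S k).head?) (S' := S)
    (by simp [guarded, h]) ?_⟩
  exact (hr.embed (M' := (guarded k p B).code) some (Option.map some) (fun _ => rfl)
    (fun _ => rfl)).1 rfl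

/-! ### Moving values between stacks -/

/-- Leaves a one-statement block. -/
abbrev done : Stm (Option Unit) := .goto fun _ => none

/-- Pops the stack `k` into the internal state. -/
abbrev popTo (k : Reg) (q : Stm (Option Unit)) : Stm (Option Unit) := .pop k (fun _ s => s) q

/-- Pushes the bit in the internal state onto the stack `k`. -/
abbrev pushBit (k : Reg) (q : Stm (Option Unit)) : Stm (Option Unit) :=
  .push k (fun v => v.getD false) q

/-- Pushes the bit `b` onto the stack `k`. -/
abbrev pushConst (k : Reg) (b : Bool) (q : Stm (Option Unit)) : Stm (Option Unit) :=
  .push k (fun _ => b) q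

/-- The loop of `scan`. The height of `cnt` is the number of trees still to be read. -/
def scanLoop (k : Reg) : Block :=
  loop .cnt Option.isSome (op (popTo .main (pushBit k
    (.branch (fun v => v.getD false) (pushConst .cnt true done)
      (.pop .cnt (fun v _ => v) done)))))

/-- Moves the topmost tree of `main` to the stack `k`. -/
def scan (k : Reg) : Block := seq (op (pushConst .cnt true done)) (scanLoop k)

/-- Stated with the remainder of the run as a hypothesis, so that in the induction the two subtrees
are read one after the other by the same loop. A `true` replaces one pending tree by two, a `false`
completes one. Each bit costs two steps, the test and the body. -/
theorem scanLoop_fst (t : Tree) {m a b d : List Bool} {T : ℕ} {S : Reg → List Bool}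
    (h : (scanLoop .fst).Sends T (stk m (t.code.reverse ++ a) b d) S) :
    (scanLoop .fst).Sends (2 * t.code.length + T) (stk (t.code ++ m) a b (true :: d)) S := by
  induction t generalizing m a d T with
  | leaf =>
    refine (loop_step (S' := stk m (false :: a) b d) rfl (op_sends fun v => ?_) h).mono ?_
    · simp [Tree.code]
    · simp [Tree.code]
  | node l r hl hr =>
    refine (loop_step (S' := stk (l.code ++ (r.code ++ m)) (true :: a) b (true :: true :: d)) rfl
      (op_sends fun v => ?_) (hl (hr (T := T) ?_))).mono ?_
    · simp [Tree.code]
    · simpa [Tree.code] using h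
    · simp [Tree.code]; omega

theorem scanLoop_snd (t : Tree) {m a b d : List Bool} {T : ℕ} {S : Reg → List Bool}
    (h : (scanLoop .snd).Sends T (stk m a (t.code.reverse ++ b) d) S) :
    (scanLoop .snd).Sends (2 * t.code.length + T) (stk (t.code ++ m) a b (true :: d)) S := by
  induction t generalizing m b d T with
  | leaf =>
    refine (loop_step (S' := stk m a (false :: b) d) rfl (op_sends fun v => ?_) h).mono ?_
    · simp [Tree.code]
    · simp [Tree.code]
  | node l r hl hr =>
    refine (loop_step (S' := stk (l.code ++ (r.code ++ m)) a (true :: b) (true :: true :: d)) rfl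
      (op_sends fun v => ?_) (hl (hr (T := T) ?_))).mono ?_
    · simp [Tree.code]
    · simpa [Tree.code] using h
    · simp [Tree.code]; omega

theorem scan_fst (t : Tree) (m a b : List Bool) :
    (scan .fst).Sends (2 * t.code.length + 2) (stk (t.code ++ m) a b [])
      (stk m (t.code.reverse ++ a) b []) :=
  (seq_sends (op_sends (S' := stk (t.code ++ m) a b [true]) fun v => by simp)
    (scanLoop_fst t (loop_exit rfl))).mono (by omega)

theorem scan_snd (t : Tree) (m a b : List Bool) :
    (scan .snd).Sends (2 * t.code.length + 2) (stk (t.code ++ m) a b [])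
      (stk m a (t.code.reverse ++ b) []) :=
  (seq_sends (op_sends (S' := stk (t.code ++ m) a b [true]) fun v => by simp)
    (scanLoop_snd t (loop_exit rfl))).mono (by omega)

/-- Pops the stack `k` until it is empty, executing `q` after each pop. -/
def drain (k : Reg) (q : Stm (Option Unit)) : Block :=
  loop k Option.isSome (op (popTo k q))

/-- `F acc l` is the loop invariant: the stacks when `l` is still on `k` and `acc` lists the popped
bits, the latest first. -/
theorem drain_sends {k : Reg} {q : Stm (Option Unit)} (F : List Bool → List Bool → Reg → List Bool)
    (hF : ∀ acc l, F acc l k = l)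
    (h : ∀ acc x l, ∃ v, TM2.stepAux q (some x) (update (F acc (x :: l)) k l) =
      ⟨some none, v, F (x :: acc) l⟩)
    (acc l : List Bool) :
    (drain k q).Sends (2 * l.length + 1) (F acc l) (F (l.reverse ++ acc) []) := by
  induction l generalizing acc with
  | nil => exact (loop_exit (by simp [hF])).mono (by omega)
  | cons x l ih =>
    refine (loop_step (S' := F (x :: acc) l) (by simp [hF]) (op_sends fun v => ?_)
      (by simpa [drain] using ih (x :: acc))).mono ?_
    · simpa [hF] using h acc x l
    · simp; omega

/-- Removes the topmost tree of `main`. -/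
def drop : Block := seq (scan .fst) (drain .fst done)

theorem drop_sends (t : Tree) (m : List Bool) :
    drop.Sends (4 * t.code.length + 3) (stk (t.code ++ m) [] [] []) (stk m [] [] []) :=
  (seq_sends (scan_fst t m [] []) (drain_sends (fun _ l => stk m l [] [])
    (fun _ _ => rfl) (fun _ x l => by simp) [] _)).mono (by simp; omega)

theorem pour_fst_main (a m b : List Bool) :
    (drain .fst (pushBit .main done)).Sends (2 * a.length + 1) (stk m a b [])
      (stk (a.reverse ++ m) [] b []) :=
  drain_sends (fun acc l => stk (acc ++ m) l b []) (fun _ _ => rfl) (fun _ x l => by simp) [] a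
    |> fun h => by simpa using h

theorem pour_snd_main (a m b : List Bool) :
    (drain .snd (pushBit .main done)).Sends (2 * b.length + 1) (stk m a b [])
      (stk (b.reverse ++ m) a [] []) :=
  drain_sends (fun acc l => stk (acc ++ m) a l []) (fun _ _ => rfl) (fun _ x l => by simp) [] b
    |> fun h => by simpa using h

theorem pour_snd_fst (m b : List Bool) :
    (drain .snd (pushBit .fst done)).Sends (2 * b.length + 1) (stk m [] b [])
      (stk m b.reverse [] []) :=
  drain_sends (k := .snd) (q := pushBit .fst done) (fun acc l => stk m acc l [])
      (fun _ _ => rfl) (fun _ x l => by simp) [] b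
    |> fun h => by simpa using h

theorem pour_fst_main_snd (a m : List Bool) :
    (drain .fst (pushBit .main (pushBit .snd done))).Sends (2 * a.length + 1) (stk m a [] [])
      (stk (a.reverse ++ m) [] a.reverse []) :=
  drain_sends (fun acc l => stk (acc ++ m) l acc []) (fun _ _ => rfl) (fun _ x l => by simp) [] a
    |> fun h => by simpa using h

/-- Exchanges the two topmost trees of `main`. -/
def swap : Block :=
  seq (scan .fst) (seq (scan .snd)
    (seq (drain .fst (pushBit .main done)) (drain .snd (pushBit .main done))))

theorem swap_sends (s t : Tree) (m : List Bool) :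
    swap.Sends (4 * s.code.length + 4 * t.code.length + 6)
      (stk (s.code ++ (t.code ++ m)) [] [] []) (stk (t.code ++ (s.code ++ m)) [] [] []) := by
  have h := seq_sends (scan_fst s (t.code ++ m) [] []) (seq_sends (scan_snd t m _ [])
    (seq_sends (pour_fst_main _ m _) (pour_snd_main [] _ _)))
  simp only [List.append_nil, List.reverse_reverse, List.length_reverse] at h
  exact h.mono (by omega)

/-- Doubles the topmost tree of `main`. -/
def dup : Block :=
  seq (scan .fst) (seq (drain .fst (pushBit .main (pushBit .snd done)))
    (seq (drain .snd (pushBit .fst done)) (drain .fst (pushBit .main done))))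

theorem dup_sends (t : Tree) (m : List Bool) :
    dup.Sends (8 * t.code.length + 5) (stk (t.code ++ m) [] [] [])
      (stk (t.code ++ (t.code ++ m)) [] [] []) := by
  have h := seq_sends (scan_fst t m [] []) (seq_sends (pour_fst_main_snd _ m)
    (seq_sends (pour_snd_fst _ _) (pour_fst_main _ _ _)))
  simp only [List.append_nil, List.reverse_reverse, List.length_reverse] at h
  exact h.mono (by omega)

end PolyTime

namespace PolyTime

open Turing Function

/-! ### Polynomially bounded functions -/

/-- Types whose elements are represented by trees. -/
class Enc (α : Type) where
  tree : α → Tree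

/-- The string that represents an element. -/
def code {α : Type} [Enc α] (a : α) : List Bool := (Enc.tree a).code

/-- The length of the string that represents an element. -/
def size {α : Type} [Enc α] (a : α) : ℕ := (code a).length

variable {α β γ σ τ : Type} [Enc α] [Enc β] [Enc γ] [Enc σ] [Enc τ]

/-- `t` is bounded by a polynomial in the size of its argument. -/
def PolyBdd (t : α → ℕ) : Prop := ∃ p : Polynomial ℕ, ∀ a, t a ≤ p.eval (size a)

theorem eval_mono (p : Polynomial ℕ) {m n : ℕ} (h : m ≤ n) : p.eval m ≤ p.eval n := by
  rw [Polynomial.eval_eq_sum_range, Polynomial.eval_eq_sum_range]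
  gcongr

theorem PolyBdd.mono {t u : α → ℕ} (h : PolyBdd u) (htu : ∀ a, t a ≤ u a) : PolyBdd t :=
  let ⟨p, hp⟩ := h
  ⟨p, fun a => (htu a).trans (hp a)⟩

theorem PolyBdd.const (n : ℕ) : PolyBdd fun _ : α => n := ⟨Polynomial.C n, fun _ => by simp⟩

theorem PolyBdd.size : PolyBdd (size : α → ℕ) := ⟨Polynomial.X, fun _ => by simp⟩

theorem PolyBdd.add {t u : α → ℕ} (ht : PolyBdd t) (hu : PolyBdd u) :
    PolyBdd fun a => t a + u a :=
  let ⟨p, hp⟩ := ht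
  let ⟨q, hq⟩ := hu
  ⟨p + q, fun a => by simpa using Nat.add_le_add (hp a) (hq a)⟩

theorem PolyBdd.mul {t u : α → ℕ} (ht : PolyBdd t) (hu : PolyBdd u) :
    PolyBdd fun a => t a * u a :=
  let ⟨p, hp⟩ := ht
  let ⟨q, hq⟩ := hu
  ⟨p * q, fun a => by simpa using Nat.mul_le_mul (hp a) (hq a)⟩

theorem PolyBdd.eval {t : α → ℕ} (p : Polynomial ℕ) (ht : PolyBdd t) :
    PolyBdd fun a => p.eval (t a) :=
  let ⟨q, hq⟩ := ht
  ⟨p.comp q, fun a => by simpa using eval_mono p (hq a)⟩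

theorem PolyBdd.comp {t : β → ℕ} {f : α → β} (ht : PolyBdd t)
    (hf : PolyBdd fun a => PolyTime.size (f a)) : PolyBdd fun a => t (f a) :=
  let ⟨p, hp⟩ := ht
  (hf.eval p).mono fun a => hp (f a)

/-! ### Polynomial time functions -/

/-- `f` is computed by a block in polynomial time, and has values of polynomial size. -/
@[fun_prop]
def PT (f : α → β) : Prop :=
  (PolyBdd fun a => size (f a)) ∧ ∃ (B : Block) (t : α → ℕ), PolyBdd t ∧
    ∀ a m, B.Sends (t a) (stk (code a ++ m) [] [] []) (stk (code (f a) ++ m) [] [] [])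

theorem PT.bdd {f : α → β} (h : PT f) : PolyBdd fun a => size (f a) := h.1

theorem PT.of_code_eq {f : α → β} (h : ∀ a, code (f a) = code a) : PT f :=
  ⟨PolyBdd.size.mono fun a => by simp [size, h], op done, fun _ => 1, .const 1,
    fun a m => op_sends fun v => by simp [h]⟩

@[fun_prop]
theorem PT.id : PT fun a : α => a := .of_code_eq fun _ => rfl

-- The size bound that is part of `PT` is needed here: the second program runs on `f a`, whose size
-- must be polynomial in that of `a`.
@[fun_prop]
theorem PT.comp {g : β → γ} {f : α → β} (hg : PT g) (hf : PT f) : PT fun a => g (f a) := by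
  obtain ⟨hg, C, u, hu, hC⟩ := hg
  obtain ⟨hf, B, t, ht, hB⟩ := hf
  exact ⟨hg.comp hf, seq B C, fun a => t a + u (f a), ht.add (hu.comp hf),
    fun a m => seq_sends (hB a m) (hC (f a) m)⟩

/-- Pushes a string onto the stack `main`. -/
def pushAll : List Bool → Stm (Option Unit)
  | [] => done
  | b :: l => pushConst .main b (pushAll l)

theorem stepAux_pushAll (l m : List Bool) (v : Option Bool) :
    TM2.stepAux (pushAll l) v (stk m [] [] []) = ⟨some none, v, stk (l.reverse ++ m) [] [] []⟩ := by
  induction l generalizing m with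
  | nil => rfl
  | cons b l ih => simp [pushAll, ih]

@[fun_prop]
theorem PT.const (b : β) : PT fun _ : α => b := by
  refine ⟨.const _, seq drop (op (pushAll (code b).reverse)), fun a => 4 * size a + 3 + 1,
    (((PolyBdd.const 4).mul .size).add (.const 3)).add (.const 1), fun a m => ?_⟩
  exact seq_sends (drop_sends (Enc.tree a) m) (op_sends fun v => by simp [stepAux_pushAll])

instance : Enc (α × β) := ⟨fun p => .node (Enc.tree p.1) (Enc.tree p.2)⟩

theorem code_pair (p : α × β) : code p = true :: (code p.1 ++ code p.2) := rfl

theorem size_pair (p : α × β) : size p = size p.1 + size p.2 + 1 := by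
  simp only [size, code_pair, List.length_cons, List.length_append]

@[fun_prop]
theorem PT.pair {f : α → β} {g : α → γ} (hf : PT f) (hg : PT g) : PT fun a => (f a, g a) := by
  obtain ⟨hf, B, t, ht, hB⟩ := hf
  obtain ⟨hg, C, u, hu, hC⟩ := hg
  -- One copy of the argument waits below while `g` is computed; after the swap `f` is computed on
  -- top, so the two codes lie in the order of the pair and only the node bit is missing.
  refine ⟨((hf.add hg).add (.const 1)).mono fun a => by simp [size_pair], seq dup (seq C
    (seq swap (seq B (op (pushConst .main true done))))),
    fun a => (8 * size a + 5) + (u a + ((4 * size (g a) + 4 * size a + 6) + (t a + 1))),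
    (((PolyBdd.const 8).mul .size).add (.const 5)).add (hu.add
      (((((PolyBdd.const 4).mul hg).add ((PolyBdd.const 4).mul .size)).add (.const 6)).add
      (ht.add (.const 1)))), fun a m => ?_⟩
  exact seq_sends (dup_sends (Enc.tree a) m) (seq_sends (hC a _) (seq_sends
    (swap_sends (Enc.tree (g a)) (Enc.tree a) m) (seq_sends (hB a _) (op_sends
      (S := stk (code (f a) ++ (code (g a) ++ m)) [] [] []) fun v => by simp [code_pair]))))

@[fun_prop]
theorem PT.fst {f : α → β × γ} (hf : PT f) : PT fun a => (f a).1 := by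
  refine PT.comp (g := Prod.fst) ⟨PolyBdd.size.mono fun p => by rw [size_pair]; omega,
    seq (op (popTo .main done)) (seq swap drop),
    fun p => 1 + ((4 * size p + 6) + (4 * size p + 3)), ?_, fun p m => ?_⟩ hf
  · exact (PolyBdd.const 1).add ((((PolyBdd.const 4).mul .size).add (.const 6)).add
      (((PolyBdd.const 4).mul .size).add (.const 3)))
  · refine (seq_sends (op_sends (S' := stk (code p.1 ++ (code p.2 ++ m)) [] [] []) fun v => ?_)
      (seq_sends (swap_sends (Enc.tree p.1) (Enc.tree p.2) m)
      (drop_sends (Enc.tree p.2) _))).mono ?_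
    · simp [code_pair]
    · simp only [size_pair]; simp only [size, code]; omega

@[fun_prop]
theorem PT.snd {f : α → β × γ} (hf : PT f) : PT fun a => (f a).2 := by
  refine PT.comp (g := Prod.snd) ⟨PolyBdd.size.mono fun p => by rw [size_pair]; omega,
    seq (op (popTo .main done)) drop,
    fun p => 1 + (4 * size p + 3), ?_, fun p m => ?_⟩ hf
  · exact (PolyBdd.const 1).add (((PolyBdd.const 4).mul .size).add (.const 3))
  · refine (seq_sends (op_sends (S' := stk (code p.1 ++ (code p.2 ++ m)) [] [] []) fun v => ?_)
      (drop_sends (Enc.tree p.1) _)).mono ?_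
    · simp [code_pair]
    · simp only [size_pair]; simp only [size, code]; omega

/-! ### Iteration and subtrees -/

/-- The loop of an iteration: `main` holds the counter and the current value. -/
def iterLoop (B : Block) : Block :=
  loop .main (fun v => v.getD false) (seq (op (popTo .main done)) (seq drop (seq swap
    (seq B swap))))

/-- Any tree serves as a counter: each round strips the root and its left subtree, so there are as
many rounds as nodes on the right spine. The leaf that ends the spine is left over as a `false`. -/
theorem iterLoop_sends {f : σ → σ} {B : Block} {t : σ → ℕ}
    (hB : ∀ a m, B.Sends (t a) (stk (code a ++ m) [] [] []) (stk (code (f a) ++ m) [] [] []))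
    (m : List Bool) (u : Tree) (b T : ℕ) (x : σ) (hb : ∀ i ≤ u.spine, size (f^[i] x) ≤ b)
    (hT : ∀ i ≤ u.spine, t (f^[i] x) ≤ T) :
    (iterLoop B).Sends (u.code.length * (T + 8 * u.code.length + 8 * b + 20))
      (stk (u.code ++ (code x ++ m)) [] [] [])
      (stk (false :: (code (f^[u.spine] x) ++ m)) [] [] []) := by
  induction u generalizing x with
  | leaf => exact (loop_exit rfl).mono (by simp [Tree.code])
  | node l r _ ih =>
    have h0 := hb 0 (Nat.zero_le _)
    have h1 := hb 1 (by simp [Tree.spine])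
    have h2 := hT 0 (Nat.zero_le _)
    have ih := ih (f x) (fun i hi => hb (i + 1) (by simpa [Tree.spine] using hi))
      (fun i hi => hT (i + 1) (by simpa [Tree.spine] using hi))
    refine (loop_step (S' := stk (r.code ++ (code (f x) ++ m)) [] [] []) rfl
      (seq_sends (op_sends (S' := stk (l.code ++ (r.code ++ (code x ++ m))) [] [] []) fun v => ?_)
      (seq_sends (drop_sends l _) (seq_sends (swap_sends r (Enc.tree x) m)
      (seq_sends (hB x _) (swap_sends (Enc.tree (f x)) r m))))) ih).mono ?_
    · simp [Tree.code]
    · simp only [iterate_zero, id, iterate_one] at h0 h1 h2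
      simp only [size, code] at h0 h1
      simp only [Tree.code, List.length_cons, List.length_append]
      nlinarith [Nat.zero_le (l.code.length), Nat.zero_le (r.code.length)]

/-- The number of iterations prescribed by an element. -/
def spine (a : α) : ℕ := (Enc.tree a).spine

/-- The bound on all intermediate values cannot be dropped: iterating a function that doubles the
size would leave polynomial time. -/
theorem PT.iterate {n : α → τ} {s : α → σ} {f : σ → σ} (hn : PT n) (hs : PT s) (hf : PT f)
    {b : α → ℕ} (hb : PolyBdd b) (h : ∀ a, ∀ i ≤ spine (n a), size (f^[i] (s a)) ≤ b a) :
    PT fun a => f^[spine (n a)] (s a) := by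
  obtain ⟨_, B, t, ⟨p, hp⟩, hB⟩ := hf
  obtain ⟨hns, C, u, hu, hC⟩ := hn.pair hs
  refine ⟨hb.mono fun a => h a _ le_rfl, seq C (seq (op (popTo .main done)) (seq (iterLoop B)
    (op (popTo .main done)))), fun a => u a + (1 + (size (n a) * (p.eval (b a) + 8 * size (n a) +
      8 * b a + 20) + 1)), ?_, fun a m => ?_⟩
  · exact hu.add ((PolyBdd.const 1).add ((hn.bdd.mul ((((hb.eval p).add
      ((PolyBdd.const 8).mul hn.bdd)).add ((PolyBdd.const 8).mul hb)).add (.const 20))).add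
      (.const 1)))
  · refine seq_sends (hC a m) (seq_sends (op_sends
      (S' := stk (code (n a) ++ (code (s a) ++ m)) [] [] []) fun v => ?_)
      (seq_sends (iterLoop_sends hB m (Enc.tree (n a)) (b a) _ (s a) (h a)
        fun i hi => (hp _).trans (eval_mono p (h a i hi))) (op_sends fun v => ?_)))
    · simp [code_pair]
    · simp [spine]

/-- Taking the right subtree, where a leaf is left unchanged. -/
theorem PT.of_right {f : α → β} (h : ∀ a, (∃ l, Enc.tree a = .node l (Enc.tree (f a))) ∨
    Enc.tree a = .leaf ∧ Enc.tree (f a) = .leaf) : PT f := by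
  have hsz : ∀ a, size (f a) ≤ size a := fun a => by
    rcases h a with ⟨l, hl⟩ | ⟨h1, h2⟩
    · simp [size, code, hl, Tree.code]; omega
    · simp [size, code, h1, h2]
  refine ⟨PolyBdd.size.mono hsz, guarded .main (fun v => v.getD false)
    (seq (op (popTo .main done)) drop), fun a => 1 + (4 * size a + 3) + 1, ?_, fun a m => ?_⟩
  · exact ((PolyBdd.const 1).add (((PolyBdd.const 4).mul .size).add (.const 3))).add (.const 1)
  · rcases h a with ⟨l, hl⟩ | ⟨h1, h2⟩
    · refine (guarded_run (by simp [code, hl, Tree.code]) (seq_sends (op_sends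
        (S' := stk (l.code ++ (code (f a) ++ m)) [] [] []) fun v => ?_) (drop_sends l _))).mono ?_
      · simp [code, hl, Tree.code]
      · simp [size, code, hl, Tree.code]; omega
    · have : code (f a) = code a := by simp [code, h1, h2]
      rw [this]
      exact (guarded_skip (by simp [code, h1, Tree.code])).mono (Nat.le_add_left _ _)

/-- Taking the left subtree, where a leaf is left unchanged. -/
theorem PT.of_left {f : α → β} (h : ∀ a, (∃ r, Enc.tree a = .node (Enc.tree (f a)) r) ∨
    Enc.tree a = .leaf ∧ Enc.tree (f a) = .leaf) : PT f := by
  have hsz : ∀ a, size (f a) ≤ size a := fun a => by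
    rcases h a with ⟨r, hr⟩ | ⟨h1, h2⟩
    · simp [size, code, hr, Tree.code]; omega
    · simp [size, code, h1, h2]
  refine ⟨PolyBdd.size.mono hsz, guarded .main (fun v => v.getD false)
    (seq (op (popTo .main done)) (seq swap drop)),
    fun a => 1 + (4 * size a + 6 + (4 * size a + 3)) + 1, ?_, fun a m => ?_⟩
  · exact ((PolyBdd.const 1).add ((((PolyBdd.const 4).mul .size).add (.const 6)).add
      (((PolyBdd.const 4).mul .size).add (.const 3)))).add (.const 1)
  · rcases h a with ⟨r, hr⟩ | ⟨h1, h2⟩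
    · refine (guarded_run (by simp [code, hr, Tree.code]) (seq_sends (op_sends
        (S' := stk (code (f a) ++ (r.code ++ m)) [] [] []) fun v => ?_)
        (seq_sends (swap_sends (Enc.tree (f a)) r m) (drop_sends r _)))).mono ?_
      · simp [code, hr, Tree.code]
      · simp [size, code, hr, Tree.code]; omega
    · have : code (f a) = code a := by simp [code, h1, h2]
      rw [this]
      exact (guarded_skip (by simp [code, h1, Tree.code])).mono (Nat.le_add_left _ _)

end PolyTime

namespace PolyTime

open Turing Function

variable {α β γ σ τ : Type} [Enc α] [Enc β] [Enc γ] [Enc σ] [Enc τ]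

/-! ### Data types -/

instance : Enc Unit := ⟨fun _ => .leaf⟩

/-- The spine has length 0 or 1, so a bit can control an iteration. Propositions get the same trees,
hence `PT` for a predicate means that it is decided in polynomial time. -/
instance : Enc Bool := ⟨fun b => if b then .node .leaf .leaf else .leaf⟩

open Classical in
noncomputable instance : Enc Prop := ⟨fun p => if p then .node .leaf .leaf else .leaf⟩

/-- The tree of a number, in unary. -/
def natTree : ℕ → Tree
  | 0 => .leaf
  | n + 1 => .node .leaf (natTree n)

instance : Enc ℕ := ⟨natTree⟩

/-- The tree of a list. -/
def listTree : List α → Tree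
  | [] => .leaf
  | a :: l => .node (Enc.tree a) (listTree l)

instance : Enc (List α) := ⟨listTree⟩

theorem code_succ (n : ℕ) : code (n + 1) = true :: false :: code n := rfl

theorem code_cons (a : α) (l : List α) : code (a :: l) = true :: (code a ++ code l) := rfl

theorem size_nat (n : ℕ) : size n = 2 * n + 1 := by
  induction n with
  | zero => rfl
  | succ n ih => simp only [size, code_succ, List.length_cons] at *; omega

theorem size_nil : size ([] : List α) = 1 := rfl

theorem size_cons (a : α) (l : List α) : size (a :: l) = size a + size l + 1 := by
  simp only [size, code_cons, List.length_cons, List.length_append]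

theorem spine_nat (n : ℕ) : spine n = n := by
  induction n with
  | zero => rfl
  | succ n ih => exact congrArg (· + 1) ih

theorem spine_list (l : List α) : spine l = l.length := by
  induction l with
  | nil => rfl
  | cons a l ih => exact congrArg (· + 1) ih

theorem length_le_size (l : List α) : l.length ≤ size l := by
  induction l with
  | nil => simp
  | cons a l ih => rw [size_cons, List.length_cons]; omega

theorem size_list_le {l : List α} {b : ℕ} (h : ∀ a ∈ l, size a ≤ b) :
    size l ≤ l.length * (b + 1) + 1 := by
  induction l with
  | nil => simp [size_nil]
  | cons a l ih =>
    have h1 := ih fun x hx => h x (List.mem_cons_of_mem _ hx)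
    have h2 := h a List.mem_cons_self
    rw [size_cons, List.length_cons, add_mul]
    omega

theorem size_bool_le (b : Bool) : size b ≤ 3 := by cases b <;> decide

/-! ### Basic functions -/

@[fun_prop]
theorem PT.succ {f : α → ℕ} (hf : PT f) : PT fun a => f a + 1 :=
  PT.comp (g := fun p : Unit × ℕ => p.2 + 1) (.of_code_eq fun _ => rfl) ((PT.const ()).pair hf)

@[fun_prop]
theorem PT.cons {f : α → β} {g : α → List β} (hf : PT f) (hg : PT g) : PT fun a => f a :: g a :=
  PT.comp (g := fun p : β × List β => p.1 :: p.2) (.of_code_eq fun _ => rfl) (hf.pair hg)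

@[fun_prop]
theorem PT.pred {f : α → ℕ} (hf : PT f) : PT fun a => f a - 1 :=
  PT.comp (g := fun n => n - 1) (.of_right fun n => by
    cases n
    · exact .inr ⟨rfl, rfl⟩
    · exact .inl ⟨_, rfl⟩) hf

@[fun_prop]
theorem PT.tail {f : α → List β} (hf : PT f) : PT fun a => (f a).tail :=
  PT.comp (g := List.tail) (.of_right fun n => by
    cases n
    · exact .inr ⟨rfl, rfl⟩
    · exact .inl ⟨_, rfl⟩) hf

theorem PT.headD {f : α → List β} {d : β} (hd : Enc.tree d = .leaf) (hf : PT f) :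
    PT fun a => (f a).headD d :=
  PT.comp (g := fun l => List.headD l d) (.of_left fun n => by
    cases n
    · exact .inr ⟨rfl, hd⟩
    · exact .inl ⟨_, rfl⟩) hf

/-- A conditional is an iteration controlled by the bit `c a`: from the pair (g, f), zero rounds of
p ↦ (p.2, p.2) leave g in front and one round brings f there. -/
theorem PT.cond {c : α → Bool} {f g : α → β} (hc : PT c) (hf : PT f) (hg : PT g) :
    PT fun a => bif c a then f a else g a := by
  have h := (PT.iterate (f := fun p : β × β => (p.2, p.2)) hc (hg.pair hf) (by fun_prop)
    (b := fun a => size (g a) + size (f a) + size (f a) + 1)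
    (((hg.bdd.add hf.bdd).add hf.bdd).add (.const 1)) fun a i _ => ?_).fst
  · convert h using 2 with a
    cases c a <;> rfl
  · rcases i with _ | i
    · simp only [iterate_zero, _root_.id, size_pair]; omega
    · have : ∀ i (p : β × β), (fun p : β × β => (p.2, p.2))^[i + 1] p = (p.2, p.2) := fun i => by
        induction i with
        | zero => exact fun _ => rfl
        | succ i ih => exact fun p => by rw [iterate_succ_apply, ih]
      simp only [this, size_pair]; omega

/-- Recursion on a number, with parameters. -/
theorem PT.rec {n : α → ℕ} {F : α → ℕ → β} {s : α → ℕ → β → β} (hn : PT n)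
    (hz : PT fun a => F a 0) (hs : PT fun p : α × ℕ × β => s p.1 p.2.1 p.2.2)
    (hF : ∀ a, ∀ i < n a, F a (i + 1) = s a i (F a i)) {b : α → ℕ} (hb : PolyBdd b)
    (h : ∀ a, ∀ i ≤ n a, size (F a i) ≤ b a) : PT fun a => F a (n a) := by
  have key : ∀ a, ∀ i ≤ n a, (fun p : α × ℕ × β => (p.1, p.2.1 + 1, s p.1 p.2.1 p.2.2))^[i]
      (a, 0, F a 0) = (a, i, F a i) := by
    intro a i hi
    induction i with
    | zero => rfl
    | succ i ih => rw [iterate_succ_apply', ih (by omega), hF a i (by omega)]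
  have h := (PT.iterate (f := fun p : α × ℕ × β => (p.1, p.2.1 + 1, s p.1 p.2.1 p.2.2)) hn
    (s := fun a => (a, 0, F a 0)) (by fun_prop) (by fun_prop)
    (b := fun a => size a + (size (n a) + b a + 1) + 1)
    ((PolyBdd.size.add ((hn.bdd.add hb).add (.const 1))).add (.const 1)) fun a i hi => ?_).snd.snd
  · convert h using 2 with a
    rw [spine_nat, key a _ le_rfl]
  · rw [spine_nat] at hi
    have := h a i hi
    rw [key a i hi]
    simp only [size_pair, size_nat]
    omega

theorem PolyBdd.val {f : α → ℕ} (hf : PT f) : PolyBdd f :=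
  hf.bdd.mono fun a => by rw [size_nat]; omega

theorem PolyBdd.size_nat {f : α → ℕ} (hf : PolyBdd f) : PolyBdd fun a => PolyTime.size (f a) :=
  (((PolyBdd.const 2).mul hf).add (.const 1)).mono fun a => by rw [PolyTime.size_nat]

@[fun_prop]
theorem PT.add {f g : α → ℕ} (hf : PT f) (hg : PT g) : PT fun a => f a + g a :=
  PT.rec (F := fun a i => f a + i) (s := fun _ _ r => r + 1) hg (by simpa using hf)
    (by fun_prop) (fun _ _ _ => rfl)
    ((PolyBdd.val hf).add (.val hg)).size_nat fun a i hi => by simp only [size_nat]; omega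

@[fun_prop]
theorem PT.mul {f g : α → ℕ} (hf : PT f) (hg : PT g) : PT fun a => f a * g a :=
  PT.rec (F := fun a i => f a * i) (s := fun a _ r => r + f a) hg (by simpa using PT.const 0)
    (by fun_prop) (fun _ _ _ => rfl)
    ((PolyBdd.val hf).mul (.val hg)).size_nat fun a i hi => by
      simp only [size_nat]; gcongr

@[fun_prop]
theorem PT.sub {f g : α → ℕ} (hf : PT f) (hg : PT g) : PT fun a => f a - g a :=
  PT.rec (F := fun a i => f a - i) (s := fun _ _ r => r - 1) hg (by simpa using hf)
    (by fun_prop) (fun _ _ _ => rfl)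
    (PolyBdd.val hf).size_nat fun a i hi => by simp only [size_nat]; omega

@[fun_prop]
theorem PT.length {f : α → List β} (hf : PT f) : PT fun a => (f a).length := by
  have := PT.iterate (s := fun _ => 0) (f := (· + 1)) hf (.const 0) (by fun_prop)
    (b := fun a => size (size (f a))) hf.bdd.size_nat fun a i hi => ?_
  · simpa [spine_list] using this
  · rw [spine_list] at hi
    have := length_le_size (f a)
    simp [size_nat]; omega

theorem size_drop_le (l : List α) (i : ℕ) : size (l.drop i) ≤ size l := by
  induction l generalizing i with
  | nil => simp
  | cons a l ih =>
    cases i with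
    | zero => simp
    | succ i => rw [List.drop_succ_cons, size_cons]; exact (ih i).trans (by omega)

@[fun_prop]
theorem PT.drop {n : α → ℕ} {f : α → List β} (hn : PT n) (hf : PT f) :
    PT fun a => (f a).drop (n a) :=
  PT.rec (F := fun a i => (f a).drop i) (s := fun _ _ r => r.tail) hn (by simpa using hf)
    (by fun_prop) (fun _ _ _ => by simp) hf.bdd fun a i _ => size_drop_le _ _

theorem PT.getD {f : α → List β} {n : α → ℕ} {d : β} (hd : Enc.tree d = .leaf) (hf : PT f)
    (hn : PT n) : PT fun a => (f a).getD (n a) d := by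
  convert PT.headD hd (PT.drop hn hf) using 2
  simp [List.headD_eq_head?_getD, List.getD_eq_getElem?_getD]

@[fun_prop]
theorem PT.getD_nat {f : α → List ℕ} {n : α → ℕ} (hf : PT f) (hn : PT n) :
    PT fun a => (f a).getD (n a) 0 := PT.getD rfl hf hn

@[fun_prop]
theorem PT.getD_bool {f : α → List Bool} {n : α → ℕ} (hf : PT f) (hn : PT n) :
    PT fun a => (f a).getD (n a) false := PT.getD rfl hf hn

/-! ### Predicates -/

@[fun_prop]
theorem PT.holds {f : α → Bool} (hf : PT f) : PT fun a => f a = true :=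
  PT.comp (g := fun b : Bool => b = true) (.of_code_eq fun b => by cases b <;> simp [code, Enc.tree])
    hf

open Classical in
theorem PT.decide {P : α → Prop} (hP : PT P) : PT fun a => decide (P a) :=
  PT.comp (g := fun p : Prop => Decidable.decide p) (.of_code_eq fun p => by simp [code, Enc.tree])
    hP

open Classical in
theorem PT.ite {P : α → Prop} {f g : α → β} (hP : PT P) (hf : PT f) (hg : PT g) :
    PT fun a => if P a then f a else g a := by
  convert PT.cond hP.decide hf hg using 2 with a
  by_cases h : P a <;> simp [h]

theorem PT.of_iff {P Q : α → Prop} (hP : PT P) (h : ∀ a, P a ↔ Q a) : PT Q := by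
  rwa [show Q = P from funext fun a => propext (h a).symm]

@[fun_prop]
theorem PT.not {P : α → Prop} (hP : PT P) : PT fun a => ¬ P a :=
  (PT.ite hP (.const False) (.const True)).of_iff fun a => by by_cases h : P a <;> simp [h]

@[fun_prop]
theorem PT.and {P Q : α → Prop} (hP : PT P) (hQ : PT Q) : PT fun a => P a ∧ Q a :=
  (PT.ite hP hQ (.const False)).of_iff fun a => by by_cases h : P a <;> simp [h]

@[fun_prop]
theorem PT.or {P Q : α → Prop} (hP : PT P) (hQ : PT Q) : PT fun a => P a ∨ Q a :=
  (PT.ite hP (.const True) hQ).of_iff fun a => by by_cases h : P a <;> simp [h]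

theorem PT.imp {P Q : α → Prop} (hP : PT P) (hQ : PT Q) : PT fun a => P a → Q a :=
  (PT.ite hP hQ (.const True)).of_iff fun a => by by_cases h : P a <;> simp [h]

theorem PT.eq_zero {f : α → ℕ} (hf : PT f) : PT fun a => f a = 0 := by
  have := PT.iterate (s := fun _ => True) (f := fun _ => False) hf (.const _) (.const _)
    (b := fun _ => 3) (.const 3) fun a i _ => ?_
  · refine this.of_iff fun a => ?_
    rw [spine_nat]
    cases f a <;> simp [iterate_succ_apply']
  · cases i <;> simp [iterate_succ_apply', size, code, Enc.tree, Tree.code]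

@[fun_prop]
theorem PT.le {f g : α → ℕ} (hf : PT f) (hg : PT g) : PT fun a => f a ≤ g a :=
  (PT.eq_zero (hf.sub hg)).of_iff fun a => by omega

@[fun_prop]
theorem PT.lt {f g : α → ℕ} (hf : PT f) (hg : PT g) : PT fun a => f a < g a :=
  (hf.succ.le hg).of_iff fun a => by omega

@[fun_prop]
theorem PT.eq {f g : α → ℕ} (hf : PT f) (hg : PT g) : PT fun a => f a = g a :=
  ((hf.le hg).and (hg.le hf)).of_iff fun a => by omega

/-! ### Bounded counting, quantification and tabulation -/

open Classical in
/-- The number of `i < n` that satisfy `P`. -/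
noncomputable def count (n : ℕ) (P : ℕ → Prop) : ℕ := ((Finset.range n).filter P).card

open Classical in
theorem count_le (n : ℕ) (P : ℕ → Prop) : count n P ≤ n :=
  (Finset.card_le_card (Finset.filter_subset _ _)).trans (Finset.card_range n).le

open Classical in
@[fun_prop]
theorem PT.count {n : α → ℕ} {P : α → ℕ → Prop} (hn : PT n)
    (hP : PT fun p : α × ℕ => P p.1 p.2) : PT fun a => count (n a) (P a) := by
  refine PT.rec (F := fun a i => PolyTime.count i (P a))
    (s := fun a i r => if P a i then r + 1 else r) hn ?_ ?_ ?_ hn.bdd ?_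
  · simpa [PolyTime.count] using PT.const 0
  · exact PT.ite (PT.comp hP (by fun_prop : PT fun p : α × ℕ × ℕ => (p.1, p.2.1)))
      (by fun_prop) (by fun_prop)
  · intro a i _
    simp only [PolyTime.count, Finset.range_add_one, Finset.filter_insert]
    split_ifs <;> simp
  · intro a i hi
    have := count_le i (P a)
    simp only [size_nat]; omega

/-- The number of counterexamples is compared with zero. -/
theorem PT.ball {n : α → ℕ} {P : α → ℕ → Prop} (hn : PT n)
    (hP : PT fun p : α × ℕ => P p.1 p.2) : PT fun a => ∀ i < n a, P a i :=
  (PT.eq_zero (PT.count (P := fun a i => ¬ P a i) hn hP.not)).of_iff fun a => by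
    simp [PolyTime.count, Finset.filter_eq_empty_iff]

/-- The list of the values of a function on `0, …, n - 1`. -/
theorem PT.table {n : α → ℕ} {F : α → ℕ → β} (hn : PT n) (hF : PT fun p : α × ℕ => F p.1 p.2) :
    PT fun a => (List.range (n a)).map (F a) := by
  obtain ⟨p, hp⟩ := hF.bdd
  -- The list is built from its end, since `cons` adds in front: after i steps it holds the last i
  -- values.
  have h := PT.rec (F := fun a i => (List.range i).map fun j => F a (n a - i + j))
    (s := fun a i r => F a (n a - (i + 1)) :: r) hn ?_ ?_ ?_
    (b := fun a => n a * (p.eval (size a + size (n a) + 1) + 1) + 1) ?_ ?_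
  · simpa using h
  · simpa using PT.const []
  · exact PT.cons (PT.comp hF (by fun_prop : PT fun p : α × ℕ × List β =>
      (p.1, n p.1 - (p.2.1 + 1)))) (by fun_prop)
  · intro a i hi
    simp only [List.range_succ_eq_map, List.map_cons, List.map_map, add_zero]
    congr 1
    refine List.map_congr_left fun j _ => ?_
    simp only [comp_apply]
    congr 1
    omega
  · exact ((PolyBdd.val hn).mul ((((PolyBdd.size.add hn.bdd).add (.const 1)).eval p).add
      (.const 1))).add (.const 1)
  · intro a i hi
    refine (size_list_le (b := p.eval (size a + size (n a) + 1)) fun x hx => ?_).trans ?_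
    · obtain ⟨j, hj, rfl⟩ := List.mem_map.1 hx
      refine (hp (a, _)).trans (eval_mono p ?_)
      rw [List.mem_range] at hj
      simp only [size_pair, size_nat]
      omega
    · simp only [List.length_map, List.length_range]
      gcongr

end PolyTime

namespace PolyTime

open Turing Function

/-! ### From polynomial time functions to Turing machines -/

theorem Run.iterate {Λ : Type} {M : Λ → Stm (Option Λ)} {M' : Option Λ → Stm (Option Λ)}
    (hM : ∀ l, M' (some l) = M l) {n l v S v' S'} (h : Run M n l v S v' S') :
    (flip bind (TM2.step M'))^[n] (some ⟨some (some l), v, S⟩) = some ⟨some none, v', S'⟩ := by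
  induction h with
  | exit h => simp [flip, TM2.step, hM, h]
  | step h _ ih => rw [iterate_succ_apply, ← ih]; simp [flip, TM2.step, hM, h]

/-- The machine that runs a block, with input stack `snd` and output stack `fst`. -/
def Block.machine (B : Block) : FinTM2 where
  K := Reg
  k₀ := .snd
  k₁ := .fst
  Γ _ := Bool
  Λ := Option B.Λ
  main := some B.entry
  σ := Option Bool
  initialState := none
  Γk₀Fin := inferInstanceAs (Fintype Bool)
  m
    -- A halting configuration must have the initial internal state, so the state is reset; this is
    -- the additional step in `Block.machine_outputs`.
    | none => .load (fun _ => none) .halt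
    | some l => B.code l

theorem Block.machine_outputs (B : Block) {w r : List Bool} {t : ℕ}
    (h : B.Sends t (stk [] [] w []) (stk [] r [] [])) :
    Nonempty (TM2OutputsInTime B.machine w (some r) (t + 1)) := by
  obtain ⟨n, hn, v, hr⟩ := h none
  suffices h : (flip bind B.machine.step)^[n + 1] (some (initList B.machine w)) =
      some (haltList B.machine r) from ⟨⟨⟨n + 1, h⟩, Nat.succ_le_succ hn⟩⟩
  have h1 : initList B.machine w = ⟨some (some B.entry), none, stk [] [] w []⟩ := by
    unfold initList
    congr 1
    funext k; cases k <;> rfl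
  have h2 : haltList B.machine r = ⟨none, none, stk [] r [] []⟩ := by
    unfold haltList
    congr 1
    funext k; cases k <;> rfl
  have h3 := hr.iterate (M' := B.machine.m) fun _ => rfl
  rw [iterate_succ_apply', h1]
  refine (congrArg (flip bind (TM2.step B.machine.m)) h3).trans ?_
  simp only [h2]
  rfl

/-- Turns the input into the code of a list. -/
def readInput : Block :=
  -- Reversing the input first makes its last bit the first to be consed onto the empty list.
  seq (drain .snd (pushBit .fst done)) (seq (op (pushConst .main false done))
    (drain .fst (.branch (fun v => v.getD false)
      (pushConst .main false (pushConst .main false (pushConst .main true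
        (pushConst .main true done))))
      (pushConst .main false (pushConst .main true done)))))

theorem readInput_sends (w : List Bool) :
    readInput.Sends (4 * w.length + 3) (stk [] [] w []) (stk (code w) [] [] []) := by
  have h := seq_sends (pour_snd_fst [] w) (seq_sends
    (op_sends (q := pushConst .main false done) (S' := stk (code ([] : List Bool)) w.reverse [] [])
      fun v => ⟨v, ?_⟩) (drain_sends (k := .fst) (q := .branch (fun v => v.getD false)
      (pushConst .main false (pushConst .main false (pushConst .main true
        (pushConst .main true done))))
      (pushConst .main false (pushConst .main true done)))
      (fun acc l => stk (code acc) l [] []) (fun _ _ => rfl) ?_ [] w.reverse))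
  · simp only [List.reverse_reverse, List.append_nil, List.length_reverse] at h
    exact h.mono (by omega)
  · simp; rfl
  · intro acc x l
    cases x
    · exact ⟨some false, by simp [code_cons]; rfl⟩
    · exact ⟨some true, by simp [code_cons]; rfl⟩

/-- Moves the code of a bit to the output. -/
def writeBit : Block := op (popTo .main (pushBit .fst (.branch (fun v => v.getD false)
  (.pop .main (fun v _ => v) (.pop .main (fun v _ => v) done)) done)))

theorem writeBit_sends (b : Bool) :
    writeBit.Sends 1 (stk (code b) [] [] []) (stk [] [b] [] []) :=
  op_sends fun v => by cases b <;> simp [code, Enc.tree, Tree.code]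

theorem size_list_bool_le (w : List Bool) : size w ≤ 4 * w.length + 1 :=
  (size_list_le fun b _ => size_bool_le b).trans (by omega)

/-- The program is framed by conversions between raw strings and codes. A string of length l has a
code of length at most 4l + 1, so the bound stays polynomial in l. -/
theorem inP_of_pt {L : Language Bool} (h : PT fun w : List Bool => w ∈ L) : InP L := by
  classical
  obtain ⟨-, B, t, ⟨p, hp⟩, hB⟩ := h.decide
  have hB' : ∀ w : List Bool, B.Sends (t w) (stk (code w) [] [] [])
      (stk (code (decide (w ∈ L))) [] [] []) := fun w => by simpa using hB w []
  let M := (seq readInput (seq B writeBit)).machine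
  have hM : ∀ w : List Bool, Nonempty (TM2OutputsInTime M w (some [decide (w ∈ L)])
      (4 * w.length + 3 + (p.eval (4 * w.length + 1) + 1) + 1)) := fun w =>
    Block.machine_outputs _ (seq_sends (readInput_sends w) (seq_sends
      ((hB' w).mono ((hp w).trans (eval_mono p (size_list_bool_le w)))) (writeBit_sends _)))
  refine ⟨fun w => decide (w ∈ L), fun w => by simp, ⟨⟨⟨M, Equiv.refl _, Equiv.refl _⟩,
    4 * Polynomial.X + 3 + (p.comp (4 * Polynomial.X + 1) + 1) + 1, fun w => ?_⟩⟩⟩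
  have h := Classical.choice (hM w)
  convert h using 1
  simp only [Equiv.invFun_as_coe, Equiv.refl_symm, Equiv.coe_refl, Polynomial.eval_add,
    Polynomial.eval_mul, Polynomial.eval_comp, Polynomial.eval_X, Polynomial.eval_one,
    Polynomial.eval_ofNat, id]
  erw [List.map_id]
  rfl

end PolyTime

/-! ### Auxiliary facts on counting -/

namespace PolyTime

open Classical in
theorem count_eq_sum (n : ℕ) (P : ℕ → Prop) :
    count n P = ∑ i ∈ Finset.range n, if P i then 1 else 0 := Finset.card_filter _ _

theorem count_mono {n : ℕ} {P Q : ℕ → Prop} (h : ∀ i < n, P i → Q i) : count n P ≤ count n Q :=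
  Finset.card_le_card fun i hi => by
    simp only [Finset.mem_filter, Finset.mem_range] at hi ⊢
    exact ⟨hi.1, h i hi.1 hi.2⟩

end PolyTime

open PolyTime

/-! ### Distributing points by fictitious play

Each vertex `v` gets the points `F v z`; for `U v z` the point goes to one of `v`, `z`. In each
round of the play, the undecided points go to the vertex that has collected less so far. -/

/-- `v` gets the point that it disputes with `z`, if `g` is what has been collected so far. -/
def Prefers (g : ℕ → ℕ) (v z : ℕ) : Prop := g v < g z ∨ g v = g z ∧ v < z

/-- The relation between `v` and `z` that `v` gets the point from `z` in the current round. -/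
def Gains (F U : ℕ → ℕ → Prop) (g : ℕ → ℕ) (v z : ℕ) : Prop := F v z ∨ U v z ∧ Prefers g v z

/-- The points collected in the first rounds. -/
noncomputable def play (m : ℕ) (F U : ℕ → ℕ → Prop) : ℕ → ℕ → ℕ
  | 0 => fun _ => 0
  | t + 1 => fun v => play m F U t v + count m (Gains F U (play m F U t) v)

/-- The points can be distributed such that nobody gets more than `S`. -/
def Distributable (m S : ℕ) (F U : ℕ → ℕ → Prop) : Prop :=
  ∃ G : ℕ → ℕ → Prop, (∀ v < m, ∀ z < m, F v z → G v z) ∧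
    (∀ v < m, ∀ z < m, U v z → G v z ∨ G z v) ∧ ∀ v < m, count m (G v) ≤ S

theorem play_le (m : ℕ) (F U : ℕ → ℕ → Prop) (t v : ℕ) : play m F U t v ≤ t * m := by
  induction t with
  | zero => simp [play]
  | succ t ih =>
    have := count_le m (Gains F U (play m F U t) v)
    simp only [play, add_mul]; omega

section
variable {m S : ℕ} {F U : ℕ → ℕ → Prop}

/-- The play is a best response: with weights that are monotone in the totals, it gives each
disputed point to the endpoint of smaller weight, and it gives no other points than the forced ones.
So it minimizes the weighted sum, pair by pair. -/
theorem sum_gains_le (hFU : ∀ v z, U v z → ¬ F v z) (hs : ∀ v z, U v z → U z v)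
    (hi : ∀ v z, U v z → v ≠ z) {G : ℕ → ℕ → Prop} (hF : ∀ v < m, ∀ z < m, F v z → G v z)
    (hU : ∀ v < m, ∀ z < m, U v z → G v z ∨ G z v) {g : ℕ → ℕ} {P : ℕ → ℤ} (h0 : ∀ v, 0 ≤ P v)
    (hP : ∀ v z, g v ≤ g z → P v ≤ P z) :
    ∑ v ∈ Finset.range m, P v * count m (Gains F U g v) ≤
      ∑ v ∈ Finset.range m, P v * count m (G v) := by
  classical
  -- Symmetrizing the double sum puts both possible receivers of a point into one summand, so that
  -- summands can be compared one by one.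
  have expand : ∀ Q : ℕ → ℕ → Prop, 2 * ∑ v ∈ Finset.range m, P v * (count m (Q v) : ℤ) =
      ∑ v ∈ Finset.range m, ∑ z ∈ Finset.range m,
        ((if Q v z then P v else 0) + if Q z v then P z else 0) := by
    intro Q
    simp only [Finset.sum_add_distrib]
    rw [Finset.sum_comm (f := fun v z => if Q z v then P z else 0), two_mul]
    congr 1 <;>
    · refine Finset.sum_congr rfl fun v _ => ?_
      rw [count_eq_sum]
      push_cast
      rw [Finset.mul_sum]
      exact Finset.sum_congr rfl fun z _ => by split_ifs <;> simp
  have key : 2 * ∑ v ∈ Finset.range m, P v * (count m (Gains F U g v) : ℤ) ≤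
      2 * ∑ v ∈ Finset.range m, P v * (count m (G v) : ℤ) := by
    rw [expand, expand]
    refine Finset.sum_le_sum fun v hv => Finset.sum_le_sum fun z hz => ?_
    rw [Finset.mem_range] at hv hz
    have := h0 v
    have := h0 z
    by_cases hvz : U v z
    · have h1 := hFU v z hvz
      have h2 := hFU z v (hs v z hvz)
      have h3 := hs v z hvz
      have h4 := hi v z hvz
      rcases lt_trichotomy (g v) (g z) with h | h | h
      · have := hP v z h.le
        rw [if_pos (.inr ⟨hvz, .inl h⟩), if_neg (by simp [Gains, Prefers, h2]; omega)]
        rcases hU v hv z hz hvz with hG | hG <;> rw [if_pos hG] <;> split_ifs <;> linarith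
      · have := hP v z h.le
        have := hP z v h.ge
        rcases lt_or_gt_of_ne h4 with h5 | h5
        · rw [if_pos (.inr ⟨hvz, .inr ⟨h, h5⟩⟩), if_neg (by simp [Gains, Prefers, h2]; omega)]
          rcases hU v hv z hz hvz with hG | hG <;> rw [if_pos hG] <;> split_ifs <;> linarith
        · rw [if_pos (c := Gains F U g z v) (.inr ⟨h3, .inr ⟨h.symm, h5⟩⟩),
            if_neg (by simp [Gains, Prefers, h1]; omega)]
          rcases hU v hv z hz hvz with hG | hG <;> rw [if_pos hG] <;> split_ifs <;> linarith
      · have := hP z v h.le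
        rw [if_pos (c := Gains F U g z v) (.inr ⟨h3, .inl h⟩),
          if_neg (by simp [Gains, Prefers, h1]; omega)]
        rcases hU v hv z hz hvz with hG | hG <;> rw [if_pos hG] <;> split_ifs <;> linarith
    · have h1 : ¬ U z v := fun h => hvz (hs z v h)
      simp only [Gains, hvz, h1, false_and, or_false]
      have := hF v hv z hz
      have := hF z hz v hv
      split_ifs <;> first | linarith | tauto
  linarith

/-- The potential is the squared distance of the totals from the region where all are at most t S.
Its linear change in a round is at most 0, because the play does no worse against the weights `P`
than `G`, which gives everybody at most S. The quadratic change is at most m² per vertex. -/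
theorem sum_excess_le (hFU : ∀ v z, U v z → ¬ F v z) (hs : ∀ v z, U v z → U z v)
    (hi : ∀ v z, U v z → v ≠ z) (hS : S ≤ m) (hd : Distributable m S F U) (t : ℕ) :
    ∑ v ∈ Finset.range m, max ((play m F U t v : ℤ) - t * S) 0 ^ 2 ≤ t * m ^ 3 := by
  obtain ⟨G, hF, hU, hG⟩ := hd
  induction t with
  | zero => simp [play]
  | succ t ih =>
    set P : ℕ → ℤ := fun v => max ((play m F U t v : ℤ) - t * S) 0 with hPdef
    have h0 : ∀ v, 0 ≤ P v := fun v => le_max_right _ _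
    have h1 := sum_gains_le hFU hs hi hF hU (g := play m F U t) h0 fun v z h =>
      max_le_max (by have : (play m F U t v : ℤ) ≤ play m F U t z := by exact_mod_cast h
                     linarith) le_rfl
    have h2 : ∑ v ∈ Finset.range m, P v * (count m (G v) : ℤ) ≤ ∑ v ∈ Finset.range m, P v * S :=
      Finset.sum_le_sum fun v hv => mul_le_mul_of_nonneg_left
        (by exact_mod_cast hG v (Finset.mem_range.1 hv)) (h0 v)
    -- With d the gain of the round minus S, the new excess is at most |P v + d|, and |d| ≤ m since
    -- gain and S both lie between 0 and m.
    have h3 : ∀ v ∈ Finset.range m, max ((play m F U (t + 1) v : ℤ) - (t + 1 : ℕ) * S) 0 ^ 2 ≤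
        P v ^ 2 + 2 * (P v * count m (Gains F U (play m F U t) v) - P v * S) + (m : ℤ) ^ 2 := by
      intro v _
      set d : ℤ := (count m (Gains F U (play m F U t) v) : ℤ) - S with hd
      have hc := count_le m (Gains F U (play m F U t) v)
      have hd2 : d ^ 2 ≤ (m : ℤ) ^ 2 := sq_le_sq.2 (by
        rw [Nat.abs_cast, abs_le]; constructor <;> omega)
      have e : (play m F U (t + 1) v : ℤ) - (t + 1 : ℕ) * S = (play m F U t v - t * S) + d := by
        simp only [play, hd]; push_cast; ring
      have h4 : max ((play m F U t v - t * S) + d) 0 ^ 2 ≤ (P v + d) ^ 2 := by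
        have h5 : (play m F U t v : ℤ) - t * S ≤ P v := le_max_left _ _
        rcases le_total ((play m F U t v - t * S) + d) 0 with h | h
        · rw [max_eq_right h]; positivity
        · rw [max_eq_left h]; exact pow_le_pow_left₀ h (by linarith) 2
      rw [e]
      refine h4.trans ?_
      have : (P v + d) ^ 2 = P v ^ 2 + 2 * (P v * count m (Gains F U (play m F U t) v) - P v * S) +
        d ^ 2 := by simp only [hd]; ring
      linarith
    refine (Finset.sum_le_sum h3).trans ?_
    simp only [Finset.sum_add_distrib, ← Finset.mul_sum, Finset.sum_sub_distrib,
      Finset.sum_const, Finset.card_range, nsmul_eq_mul]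
    push_cast
    have ih : ∑ v ∈ Finset.range m, P v ^ 2 ≤ t * m ^ 3 := ih
    rw [show ((t : ℤ) + 1) * m ^ 3 = t * m ^ 3 + m * m ^ 2 by ring]
    linarith

/-- An excess of T/m at a single vertex would give T²/m² ≤ T m³ in the potential bound, that is T ≤
m^5. -/
theorem Distributable.play_lt (hFU : ∀ v z, U v z → ¬ F v z) (hs : ∀ v z, U v z → U z v)
    (hi : ∀ v z, U v z → v ≠ z) (hS : S ≤ m) (hd : Distributable m S F U) {T : ℕ}
    (hT : m ^ 5 < T) {v : ℕ} (hv : v < m) : m * play m F U T v < T + m * T * S := by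
  by_contra! h
  have h1 := sum_excess_le hFU hs hi hS hd T
  have h2 := (Finset.single_le_sum (f := fun v => max ((play m F U T v : ℤ) - T * S) 0 ^ 2)
    (fun _ _ => by positivity) (Finset.mem_range.2 hv)).trans h1
  set x : ℤ := max ((play m F U T v : ℤ) - T * S) 0 with hx
  have h3 : (T : ℤ) ≤ m * x := by
    have h4 : (play m F U T v : ℤ) - T * S ≤ x := le_max_left _ _
    have h5 : (T : ℤ) + m * T * S ≤ m * play m F U T v := by exact_mod_cast h
    nlinarith
  have h6 : (T : ℤ) ^ 2 ≤ (m * x) ^ 2 := pow_le_pow_left₀ (by positivity) h3 2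
  have h7 : (T : ℤ) * T ≤ T * m ^ 5 := by nlinarith [sq_nonneg (m : ℤ)]
  have h8 : (m : ℤ) ^ 5 < T := by exact_mod_cast hT
  have h9 : (0 : ℤ) < T := lt_of_le_of_lt (by positivity) h8
  nlinarith

/-- Distributing points means matching them into S slots per vertex. A violation of Hall's condition
is a set of more than |W| S points that only vertices of W can receive. The play gives W at least
that many points per round, contradicting the bound on the totals since |W| ≤ m. -/
theorem distributable_of_play_lt (hFU : ∀ v z, U v z → ¬ F v z) (hs : ∀ v z, U v z → U z v)
    (hi : ∀ v z, U v z → v ≠ z) {T : ℕ}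
    (h : ∀ v < m, m * play m F U T v < T + m * T * S) : Distributable m S F U := by
  classical
  -- One element per point: forced points are ordered pairs with the receiver first, disputed ones
  -- are listed once with the smaller vertex first.
  let E := {p : ℕ × ℕ // p.1 < m ∧ p.2 < m ∧ (F p.1 p.2 ∨ U p.1 p.2 ∧ p.1 < p.2)}
  let own : E → Finset ℕ := fun e => if F e.1.1 e.1.2 then {e.1.1} else {e.1.1, e.1.2}
  by_cases hall : ∀ A : Finset E, A.card ≤ (A.biUnion fun e => own e ×ˢ Finset.range S).card
  · obtain ⟨f, hf, hft⟩ := (Finset.all_card_le_biUnion_card_iff_exists_injective _).1 hall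
    simp only [Finset.mem_product, Finset.mem_range] at hft
    refine ⟨fun v z => ∃ e : E, (e.1 = (v, z) ∨ e.1 = (z, v)) ∧ (f e).1 = v, ?_, ?_, ?_⟩
    · intro v hv z hz hF
      refine ⟨⟨(v, z), hv, hz, .inl hF⟩, .inl rfl, ?_⟩
      simpa [own, hF] using (hft ⟨(v, z), hv, hz, .inl hF⟩).1
    · intro v hv z hz hU
      have h1 := hFU v z hU
      have h2 := hFU z v (hs v z hU)
      rcases lt_or_gt_of_ne (hi v z hU) with h3 | h3
      · have h4 := (hft ⟨(v, z), hv, hz, .inr ⟨hU, h3⟩⟩).1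
        simp only [own, h1, if_false, Finset.mem_insert, Finset.mem_singleton] at h4
        exact h4.imp (fun h4 => ⟨_, .inl rfl, h4⟩) fun h4 => ⟨_, .inr rfl, h4⟩
      · have h4 := (hft ⟨(z, v), hz, hv, .inr ⟨hs v z hU, h3⟩⟩).1
        simp only [own, h2, if_false, Finset.mem_insert, Finset.mem_singleton] at h4
        exact h4.symm.imp (fun h4 => ⟨_, .inr rfl, h4⟩) fun h4 => ⟨_, .inl rfl, h4⟩
    · intro v _
      have key : ∀ z : ℕ, ∃ j, (∃ e : E, (e.1 = (v, z) ∨ e.1 = (z, v)) ∧ (f e).1 = v) →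
          ∃ e : E, (e.1 = (v, z) ∨ e.1 = (z, v)) ∧ f e = (v, j) := fun z => by
        by_cases hz : ∃ e : E, (e.1 = (v, z) ∨ e.1 = (z, v)) ∧ (f e).1 = v
        · obtain ⟨e, he, hv⟩ := hz
          exact ⟨(f e).2, fun _ => ⟨e, he, by rw [← hv]⟩⟩
        · exact ⟨0, fun h => absurd h hz⟩
      choose j hj using key
      rw [← Finset.card_range S]
      refine Finset.card_le_card_of_injOn j (fun z hz => ?_) fun z hz z' hz' hjj => ?_
      · obtain ⟨e, -, he⟩ := hj z (Finset.mem_filter.1 hz).2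
        have := (hft e).2
        rw [he] at this
        simpa using this
      · obtain ⟨e, he, hf1⟩ := hj z (Finset.mem_filter.1 hz).2
        obtain ⟨e', he', hf2⟩ := hj z' (Finset.mem_filter.1 hz').2
        rw [hjj, ← hf2] at hf1
        obtain rfl := hf hf1
        rcases he with he | he <;> rcases he' with he' | he' <;> rw [he] at he' <;>
          simp only [Prod.mk.injEq] at he' <;> omega
  · push Not at hall
    exfalso
    obtain ⟨A, hA⟩ := hall
    set W := A.biUnion own with hW
    have hWm : ∀ v ∈ W, v < m := by
      intro v hv
      obtain ⟨e, -, he⟩ := Finset.mem_biUnion.1 hv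
      have h1 := e.2.1
      have h2 := e.2.2.1
      simp only [own] at he
      split_ifs at he <;> simp only [Finset.mem_insert, Finset.mem_singleton] at he <;> omega
    have hcard : W.card * S < A.card := by
      have : (A.biUnion fun e => own e ×ˢ Finset.range S) = W ×ˢ Finset.range S := by
        ext p
        simp only [hW, Finset.mem_biUnion, Finset.mem_product]
        tauto
      rwa [this, Finset.card_product, Finset.card_range] at hA
    have hround : ∀ g : ℕ → ℕ, A.card ≤ ∑ v ∈ W, count m (Gains F U g v) := by
      intro g
      rw [show ∑ v ∈ W, count m (Gains F U g v) = (W.sigma fun v =>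
        (Finset.range m).filter (Gains F U g v)).card from (Finset.card_sigma _ _).symm]
      -- Each point goes to the pair (receiver in this round, other vertex). Points with equal
      -- images coincide, because a disputed pair is listed once and carries no forced point.
      refine Finset.card_le_card_of_injOn (fun e => if F e.1.1 e.1.2 ∨ Prefers g e.1.1 e.1.2 then
        ⟨e.1.1, e.1.2⟩ else ⟨e.1.2, e.1.1⟩) (fun e he => ?_) fun e he e' he' hee => ?_
      · obtain ⟨⟨a, b⟩, ha, hb, hab⟩ := e
        have hmem : ∀ x, x ∈ own ⟨(a, b), ha, hb, hab⟩ → x ∈ W := fun x hx =>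
          Finset.mem_biUnion.2 ⟨_, he, hx⟩
        simp only at ha hb hab
        by_cases hF : F a b
        · simp only [hF, true_or, if_true]
          simp only [Finset.coe_sigma, Set.mem_sigma_iff, Finset.mem_coe, Finset.mem_filter,
            Finset.mem_range]
          exact ⟨hmem _ (by simp [own, hF]), hb, .inl hF⟩
        · obtain ⟨hU, hlt⟩ := hab.resolve_left hF
          simp only [hF, false_or]
          split_ifs with hp
          · simp only [Finset.coe_sigma, Set.mem_sigma_iff, Finset.mem_coe, Finset.mem_filter,
              Finset.mem_range]
            exact ⟨hmem _ (by simp [own, hF]), hb, .inr ⟨hU, hp⟩⟩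
          · simp only [Finset.coe_sigma, Set.mem_sigma_iff, Finset.mem_coe, Finset.mem_filter,
              Finset.mem_range]
            exact ⟨hmem _ (by simp [own, hF]), ha, .inr ⟨hs _ _ hU, by
              simp only [Prefers] at hp ⊢; omega⟩⟩
      · obtain ⟨⟨a, b⟩, ha, hb, hab⟩ := e
        obtain ⟨⟨a', b'⟩, ha', hb', hab'⟩ := e'
        simp only at ha hb hab ha' hb' hab' hee
        split_ifs at hee with h1 h2 h2 <;> simp only [Sigma.mk.injEq, heq_eq_eq] at hee <;>
          obtain ⟨rfl, rfl⟩ := hee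
        · rfl
        · exfalso
          obtain ⟨hU, hlt⟩ := hab'.resolve_left fun h => h2 (.inl h)
          rcases hab with h | h
          · exact hFU _ _ (hs _ _ hU) h
          · omega
        · exfalso
          obtain ⟨hU, hlt⟩ := hab.resolve_left fun h => h1 (.inl h)
          rcases hab' with h | h
          · exact hFU _ _ (hs _ _ hU) h
          · omega
        · rfl
    have hsum : ∀ t, t * A.card ≤ ∑ v ∈ W, play m F U t v := by
      intro t
      induction t with
      | zero => simp
      | succ t ih =>
        simp only [play, Finset.sum_add_distrib, add_mul, one_mul]
        exact add_le_add ih (hround _)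
    have hWne : W.Nonempty := by
      have hApos : 0 < A.card := by omega
      obtain ⟨e, he⟩ := Finset.card_pos.1 hApos
      exact ⟨e.1.1, Finset.mem_biUnion.2 ⟨e, he, by simp only [own]; split_ifs <;> simp⟩⟩
    have hWc : W.card ≤ m := by
      rw [← Finset.card_range m]
      exact Finset.card_le_card fun v hv => Finset.mem_range.2 (hWm v hv)
    have h1 : ∑ v ∈ W, m * play m F U T v < ∑ _v ∈ W, (T + m * T * S) :=
      Finset.sum_lt_sum_of_nonempty hWne fun v hv => h v (hWm v hv)
    rw [← Finset.mul_sum, Finset.sum_const, smul_eq_mul] at h1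
    have h2 := hsum T
    have h3 : m * (T * (W.card * S + 1)) ≤ m * ∑ v ∈ W, play m F U T v :=
      Nat.mul_le_mul_left _ ((Nat.mul_le_mul_left _ hcard).trans h2)
    nlinarith [Nat.mul_le_mul_right T hWc]

/-- Fictitious play decides whether the points can be distributed. -/
theorem distributable_iff (hFU : ∀ v z, U v z → ¬ F v z) (hs : ∀ v z, U v z → U z v)
    (hi : ∀ v z, U v z → v ≠ z) (hS : S ≤ m) {T : ℕ} (hT : m ^ 5 < T) :
    Distributable m S F U ↔ ∀ v < m, m * play m F U T v < T + m * T * S :=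
  ⟨fun h _ hv => h.play_lt hFU hs hi hS hT hv, distributable_of_play_lt hFU hs hi⟩

end

/-! ### Extensions of partial votes -/

section
variable {m n : ℕ}

theorem PartialVote.undetermined_unique {p : PartialVote m} (h : p.numUndetermined ≤ 1)
    {x y x' y' : Fin m} (h1 : ¬ p.pref x y) (h2 : ¬ p.pref y x) (h1' : ¬ p.pref x' y')
    (h2' : ¬ p.pref y' x') : x = x' ∧ y = y' ∨ x = y' ∧ y = x' := by
  have := p.isPartialOrder
  have hne : ∀ {a b}, ¬ p.pref a b → a ≠ b := fun {a b} hab e => hab (e ▸ refl_of p.pref a)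
  have huniq : ∀ a b, a ∈ {q : Fin m × Fin m | q.1 < q.2 ∧ ¬ p.pref q.1 q.2 ∧ ¬ p.pref q.2 q.1} →
      b ∈ {q : Fin m × Fin m | q.1 < q.2 ∧ ¬ p.pref q.1 q.2 ∧ ¬ p.pref q.2 q.1} → a = b :=
    fun _ _ => (Set.ncard_le_one_iff (Set.toFinite _)).1 h
  rcases lt_or_gt_of_ne (hne h1) with hl | hl <;> rcases lt_or_gt_of_ne (hne h1') with hl' | hl'
  · exact .inl <| by simpa using huniq (x, y) (x', y') ⟨hl, h1, h2⟩ ⟨hl', h1', h2'⟩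
  · exact .inr <| by simpa using huniq (x, y) (y', x') ⟨hl, h1, h2⟩ ⟨hl', h2', h1'⟩
  · have := huniq (y, x) (x', y') ⟨hl, h2, h1⟩ ⟨hl', h1', h2'⟩
    simp only [Prod.mk.injEq] at this
    exact .inr this.symm
  · have := huniq (y, x) (y', x') ⟨hl, h2, h1⟩ ⟨hl', h2', h1'⟩
    simp only [Prod.mk.injEq] at this
    exact .inl this.symm

/-- A partial vote with at most one undetermined pair is completed by ordering this pair. -/
theorem PartialVote.exists_extension {p : PartialVote m} (h : p.numUndetermined ≤ 1)
    {R : Fin m → Fin m → Prop} (hR : ∀ x y, x ≠ y → (R x y ↔ ¬ R y x)) :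
    ∃ v : CompleteVote m, v.Extends p ∧
      ∀ x y, x ≠ y → (v.pref x y ↔ p.pref x y ∨ ¬ p.pref x y ∧ ¬ p.pref y x ∧ R x y) := by
  have hp := p.isPartialOrder
  have hne : ∀ {a b}, ¬ p.pref a b → a ≠ b := fun {a b} hab e => hab (e ▸ refl_of p.pref a)
  refine ⟨⟨fun x y => p.pref x y ∨ ¬ p.pref x y ∧ ¬ p.pref y x ∧ R x y, ?_⟩,
    fun x y hxy => .inl hxy, fun x y _ => Iff.rfl⟩
  refine { refl := fun x => .inl (refl_of p.pref x), trans := ?_, antisymm := ?_, total := ?_ }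
  -- If one of the two steps is fixed and x, z are not fixed in this order, transitivity of `p`
  -- excludes the reverse order too. Then x, z is a second undetermined pair and must equal the
  -- first. Two undetermined steps lead back to the start.
  · rintro x y z (hxy | ⟨hxy, hyx, hr⟩) (hyz | ⟨hyz, hzy, hr'⟩)
    · exact .inl (trans_of p.pref hxy hyz)
    · by_cases hxz : p.pref x z
      · exact .inl hxz
      · have hzx : ¬ p.pref z x := fun hzx => hzy (trans_of p.pref hzx hxy)
        rcases undetermined_unique h hxz hzx hyz hzy with ⟨rfl, -⟩ | ⟨rfl, rfl⟩
        · exact .inr ⟨hxz, hzx, hr'⟩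
        · exact absurd (refl_of p.pref _) hxz
    · by_cases hxz : p.pref x z
      · exact .inl hxz
      · have hzx : ¬ p.pref z x := fun hzx => hyx (trans_of p.pref hyz hzx)
        rcases undetermined_unique h hxz hzx hxy hyx with ⟨-, rfl⟩ | ⟨rfl, rfl⟩
        · exact .inr ⟨hxz, hzx, hr⟩
        · exact absurd (refl_of p.pref _) hxz
    · rcases undetermined_unique h hxy hyx hyz hzy with ⟨rfl, rfl⟩ | ⟨rfl, -⟩
      · exact absurd (refl_of p.pref _) hxy
      · exact .inl (refl_of p.pref _)
  · rintro x y (hxy | ⟨hxy, hyx, hr⟩) (hyx' | ⟨hyx', hxy', hr'⟩)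
    · exact antisymm_of p.pref hxy hyx'
    · exact absurd hxy hxy'
    · exact absurd hyx' hyx
    · exact absurd hr' ((hR x y (hne hxy)).1 hr)
  · intro x y
    by_cases hxy : p.pref x y
    · exact .inl (.inl hxy)
    · by_cases hyx : p.pref y x
      · exact .inr (.inl hyx)
      · by_cases hr : R x y
        · exact .inl (.inr ⟨hxy, hyx, hr⟩)
        · exact .inr (.inr ⟨hyx, hxy, (hR y x (hne hyx)).2 hr⟩)

/-- The number of votes of a profile that place `x` before `y`. -/
noncomputable def support (V : Fin n → CompleteVote m) (x y : Fin m) : ℕ :=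
  {i | (V i).pref x y}.ncard

/-- The number of partial votes that place `x` before `y`. -/
noncomputable def fixedSupport (p : Fin n → PartialVote m) (x y : Fin m) : ℕ :=
  {i | (p i).pref x y}.ncard

theorem support_add (V : Fin n → CompleteVote m) {x y : Fin m} (h : x ≠ y) :
    support V x y + support V y x = n := by
  rw [support, support, ← Set.ncard_union_eq]
  · rw [show {i | (V i).pref x y} ∪ {i | (V i).pref y x} = Set.univ from
      Set.eq_univ_of_forall fun i => ((V i).isLinearOrder).total x y]
    simp
  · exact Set.disjoint_left.2 fun i h1 h2 => h (((V i).isLinearOrder).antisymm x y h1 h2)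

theorem fixedSupport_le {V : Fin n → CompleteVote m} {p : Fin n → PartialVote m}
    (h : ∀ i, (V i).Extends (p i)) (x y : Fin m) : fixedSupport p x y ≤ support V x y :=
  Set.ncard_le_ncard fun i hi => h i x y hi

theorem fixedSupport_add (p : Fin n → PartialVote m) {x y : Fin m} (h : x ≠ y) :
    fixedSupport p x y + fixedSupport p y x +
      {i | ¬ (p i).pref x y ∧ ¬ (p i).pref y x}.ncard = n := by
  have hd : Disjoint {i | (p i).pref x y} {i | (p i).pref y x} :=
    Set.disjoint_left.2 fun i h1 h2 => h (((p i).isPartialOrder).antisymm x y h1 h2)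
  have hc : {i | ¬ (p i).pref x y ∧ ¬ (p i).pref y x} =
      ({i | (p i).pref x y} ∪ {i | (p i).pref y x})ᶜ := by
    ext i; simp
  have := Set.ncard_add_ncard_compl ({i | (p i).pref x y} ∪ {i | (p i).pref y x})
  rw [Set.ncard_union_eq hd] at this
  rw [hc, fixedSupport, fixedSupport, this, Nat.card_fin]

/-- The pairs are independent of each other, and all supports between the bounds occur. -/
theorem exists_profile {p : Fin n → PartialVote m} (hp : ∀ i, (p i).numUndetermined ≤ 1)
    {N : Fin m → Fin m → ℕ} (hN : ∀ x y, x ≠ y → N x y + N y x = n)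
    (hf : ∀ x y, x ≠ y → fixedSupport p x y ≤ N x y) :
    ∃ V : Fin n → CompleteVote m, (∀ i, (V i).Extends (p i)) ∧
      ∀ x y, x ≠ y → support V x y = N x y := by
  -- `Z x y` is a set of undecided voters who will place x first, of the size that is missing to `N
  -- x y`. Only the sets with x < y are used, so the choices for the two orders cannot conflict.
  have hZ : ∀ x y, ∃ Z ⊆ {i | ¬ (p i).pref x y ∧ ¬ (p i).pref y x}, x ≠ y →
      Z.ncard = N x y - fixedSupport p x y := by
    intro x y
    by_cases hxy : x = y
    · exact ⟨∅, Set.empty_subset _, fun h => absurd hxy h⟩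
    · have h1 := fixedSupport_add p hxy
      have h2 := hN x y hxy
      have h3 := hf y x (Ne.symm hxy)
      obtain ⟨Z, hZ, hc⟩ := Set.exists_subset_card_eq
        (s := {i | ¬ (p i).pref x y ∧ ¬ (p i).pref y x})
        (n := N x y - fixedSupport p x y) (by omega)
      exact ⟨Z, hZ, fun _ => hc⟩
  choose Z hZsub hZc using hZ
  have hV := fun i => PartialVote.exists_extension (hp i)
    (R := fun x y => x < y ∧ i ∈ Z x y ∨ y < x ∧ i ∉ Z y x) fun x y hxy => by
      rcases lt_or_gt_of_ne hxy with h | h <;> simp [h, h.not_gt]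
  choose V hext hpref using hV
  have hlt : ∀ x y, x < y → support V x y = N x y := by
    intro x y hxy
    have h1 : {i | (V i).pref x y} = {i | (p i).pref x y} ∪ Z x y := by
      ext i
      simp only [Set.mem_ofPred_eq, hpref i x y hxy.ne, Set.mem_union, hxy, hxy.not_gt, true_and,
        false_and, or_false]
      have := @hZsub x y i
      simp only [Set.mem_ofPred_eq] at this
      tauto
    have h2 : Disjoint {i | (p i).pref x y} (Z x y) :=
      Set.disjoint_left.2 fun i h2 h3 => (hZsub x y h3).1 h2
    rw [support, h1, Set.ncard_union_eq h2, hZc x y hxy.ne]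
    exact Nat.add_sub_of_le (hf x y hxy.ne)
  refine ⟨V, hext, fun x y hxy => ?_⟩
  rcases lt_or_gt_of_ne hxy with h | h
  · exact hlt x y h
  · have h1 := hlt y x h
    have h2 := support_add V hxy
    have h3 := hN x y hxy
    omega

/-! ### Copeland scores -/

/-- The number of points of `x` if `N` gives the supports, where `s = 1` if ties give a point. -/
noncomputable def points (s n : ℕ) (N : Fin m → Fin m → ℕ) (x : Fin m) : ℕ :=
  {y | y ≠ x ∧ n < 2 * N x y + s}.ncard

/-- The margin is 2 N − n for the support N, so a win means n < 2 N and a win or tie means n < 2 N +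
1. -/
theorem copelandScore_eq {s : ℕ} (hs : s ≤ 1) (V : Fin n → CompleteVote m) (x : Fin m) :
    copelandScore s V x = points s n (support V) x := by
  have hm : ∀ y, margin V x y = (support V x y : ℤ) - support V y x := fun _ => rfl
  have hadd : ∀ y, y ≠ x → support V x y + support V y x = n := fun y h => support_add V h.symm
  rw [copelandScore, points]
  interval_cases s
  · simp only [Nat.cast_zero, zero_mul, add_zero]
    congr 2
    ext y
    simp only [Set.mem_ofPred_eq, hm]
    refine and_congr_right fun h => ?_
    have := hadd y h
    omega
  · rw [Nat.cast_one, one_mul, ← Nat.cast_add, ← Set.ncard_union_eq]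
    · congr 2
      ext y
      simp only [Set.mem_union, Set.mem_ofPred_eq, hm, ← and_or_left]
      refine and_congr_right fun h => ?_
      have := hadd y h
      omega
    · exact Set.disjoint_left.2 fun y h1 h2 => h1.2.ne' h2.2

theorem mem_copeland_iff {s : ℕ} (hs : s ≤ 1) (V : Fin n → CompleteVote m) (c : Fin m) :
    c ∈ copeland s n m V ↔ ∀ y, points s n (support V) y ≤ points s n (support V) c := by
  simp only [copeland, Set.mem_ofPred_eq, copelandScore_eq hs, Nat.cast_le]

end

/-! ### Counting over indices in `Fin n` -/

section
variable {m n : ℕ}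

theorem ncard_eq_count (n : ℕ) (Q : ℕ → Prop) : {i : Fin n | Q i}.ncard = count n Q := by
  classical
  rw [count, ← Set.ncard_coe_finset, ← Set.ncard_image_of_injective _ Fin.val_injective]
  congr 1
  ext i
  simp only [Set.mem_image, Set.mem_ofPred_eq, Finset.coe_filter, Finset.mem_range]
  exact ⟨fun ⟨j, hj, e⟩ => e ▸ ⟨j.2, hj⟩, fun ⟨hi, hq⟩ => ⟨⟨i, hi⟩, hq, rfl⟩⟩

/-! ### The points that are decided by the partial votes

In this section `P x y` is the number of partial votes that place `x` before `y`. -/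

/-- `x` gets a point from `y` in all extensions in which `c` wins all the pairs it can win. -/
def Forced (s n c : ℕ) (P : ℕ → ℕ → ℕ) (x y : ℕ) : Prop := x ≠ c ∧ x ≠ y ∧ n < 2 * P x y + s

/-- The extensions decide which one of `x` and `y` gets a point. -/
def Disputed (s n c : ℕ) (P : ℕ → ℕ → ℕ) (x y : ℕ) : Prop :=
  x ≠ c ∧ y ≠ c ∧ x ≠ y ∧ 2 * P x y + s ≤ n ∧ 2 * P y x + s ≤ n ∧ ¬ (s = 0 ∧ 2 * (n / 2) = n)

/-- The largest number of points that `c` can get. -/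
noncomputable def goal (s n m c : ℕ) (P : ℕ → ℕ → ℕ) : ℕ :=
  count m fun y => y ≠ c ∧ 2 * P y c < n + s

theorem not_forced_of_disputed {s n c : ℕ} {P : ℕ → ℕ → ℕ} {x y : ℕ} (h : Disputed s n c P x y) :
    ¬ Forced s n c P x y := fun h' => by
  have h1 := h.2.2.2.1
  have h2 := h'.2.2
  omega

theorem disputed_symm {s n c : ℕ} {P : ℕ → ℕ → ℕ} {x y : ℕ} (h : Disputed s n c P x y) :
    Disputed s n c P y x := ⟨h.2.1, h.1, h.2.2.1.symm, h.2.2.2.2.1, h.2.2.2.1, h.2.2.2.2.2⟩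

theorem goal_le (s n m c : ℕ) (P : ℕ → ℕ → ℕ) : goal s n m c P ≤ m := count_le _ _

theorem points_eq_count {s : ℕ} {N : Fin m → Fin m → ℕ} {N' : ℕ → ℕ → ℕ}
    (h : ∀ x y : Fin m, N' x y = N x y) (x : Fin m) :
    points s n N x = count m fun y => y ≠ x ∧ n < 2 * N' x y + s := by
  rw [← ncard_eq_count, points]
  congr 1
  ext y
  simp only [Set.mem_ofPred_eq, h, Fin.val_inj, ne_eq]

/-- From a winning extension, the points collected by the rivals of `c` form a distribution, and the
score of `c` is at most `goal`. Conversely, a distribution prescribes supports that are realized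
independently; then `c` reaches `goal` and every rival has at most the points that `G` grants. -/
theorem exists_winning_extension_iff {s : ℕ} (hs : s ≤ 1) {p : Fin n → PartialVote m}
    (hp : ∀ i, (p i).numUndetermined ≤ 1) (c : Fin m) {P : ℕ → ℕ → ℕ}
    (hP : ∀ x y : Fin m, P x y = fixedSupport p x y) :
    (∃ V : Fin n → CompleteVote m, (∀ i, (V i).Extends (p i)) ∧ c ∈ copeland s n m V) ↔
      Distributable m (goal s n m c P) (Forced s n c P) (Disputed s n c P) := by
  classical
  have hsum : ∀ x y : Fin m, x ≠ y → P x y + P y x ≤ n := fun x y h => by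
    have := fixedSupport_add p h
    rw [hP, hP]; omega
  constructor
  · rintro ⟨V, hV, hc⟩
    rw [mem_copeland_iff hs] at hc
    let N : ℕ → ℕ → ℕ := fun x y =>
      if h : x < m ∧ y < m then support V ⟨x, h.1⟩ ⟨y, h.2⟩ else 0
    have hN : ∀ x y : Fin m, N x y = support V x y := fun x y => by simp [N]
    have hPN : ∀ x y : Fin m, P x y ≤ N x y := fun x y => by
      rw [hN, hP]; exact fixedSupport_le hV x y
    have hNN : ∀ x y : Fin m, x ≠ y → N x y + N y x = n := fun x y h => by
      rw [hN, hN]; exact support_add V h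
    refine ⟨fun x y => x ≠ c ∧ x ≠ y ∧ n < 2 * N x y + s, ?_, ?_, ?_⟩
    · rintro v hv z hz ⟨h1, h2, h3⟩
      have := hPN ⟨v, hv⟩ ⟨z, hz⟩
      exact ⟨h1, h2, by simp only at this; omega⟩
    · rintro v hv z hz ⟨h1, h2, h3, h4, h5, h6⟩
      have := hNN ⟨v, hv⟩ ⟨z, hz⟩ (by simpa using h3)
      simp only at this
      by_contra! h
      have := h.1 h1 h3
      have := h.2 h2 h3.symm
      omega
    · intro v hv
      by_cases hvc : v = c
      · simp [count, hvc]
      · have h1 := hc ⟨v, hv⟩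
        rw [points_eq_count hN, points_eq_count hN] at h1
        refine (count_mono fun z _ hz => ⟨hz.2.1.symm, hz.2.2⟩).trans (h1.trans
          (count_mono fun z hz h => ⟨h.1, ?_⟩))
        have h2 := hPN ⟨z, hz⟩ c
        have h3 := hNN ⟨z, hz⟩ c (by simpa [Fin.ext_iff] using h.1)
        have h4 := h.2
        simp only at h2 h3
        omega
  · rintro ⟨G, hF, hU, hG⟩
    -- A forced or granted point is realized by the largest possible support of its receiver, and a
    -- pair that can be left without points is tied. `N` uses `M` only for x < y and takes
    -- complements otherwise, so the supports of a pair add up to n by construction.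
    let M : Fin m → Fin m → ℕ := fun x y =>
      if Forced s n c P x y then n - P y x else if Forced s n c P y x then P x y
      else if s = 0 ∧ 2 * (n / 2) = n then n / 2 else if G x y then n - P y x else P x y
    let N : Fin m → Fin m → ℕ := fun x y =>
      if x = c then n - P y x else if y = c then P x y else if x < y then M x y else n - M y x
    have hM : ∀ x y, x ≠ y → x ≠ c → y ≠ c → P x y ≤ M x y ∧ M x y + P y x ≤ n := by
      intro x y hxy hx hy
      have := hsum x y hxy
      simp only [M]
      split_ifs with h1 h2 h3
      any_goals omega
      simp only [Forced, Fin.val_inj, ne_eq, hx, hy, hxy, Ne.symm hxy, not_false_eq_true,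
        true_and] at h1 h2
      omega
    have hadd : ∀ x y, x ≠ y → N x y + N y x = n := by
      intro x y hxy
      have h1 := hsum x y hxy
      simp only [N]
      rcases lt_or_gt_of_ne hxy with h | h
      · by_cases hx : x = c
        · have : y ≠ c := fun e => hxy (hx.trans e.symm)
          rw [if_pos hx, if_neg this, if_pos hx]; omega
        · by_cases hy : y = c
          · rw [if_neg hx, if_pos hy, if_pos hy]; omega
          · have := hM x y hxy hx hy
            rw [if_neg hx, if_neg hy, if_pos h, if_neg hy, if_neg hx, if_neg h.not_gt]; omega
      · by_cases hx : x = c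
        · have : y ≠ c := fun e => hxy (hx.trans e.symm)
          rw [if_pos hx, if_neg this, if_pos hx]; omega
        · by_cases hy : y = c
          · rw [if_neg hx, if_pos hy, if_pos hy]; omega
          · have := hM y x hxy.symm hy hx
            rw [if_neg hx, if_neg hy, if_neg h.not_gt, if_neg hy, if_neg hx, if_pos h]; omega
    have hPN : ∀ x y, x ≠ y → fixedSupport p x y ≤ N x y := by
      intro x y hxy
      rw [← hP]
      have h1 := hsum x y hxy
      simp only [N]
      split_ifs with hx hy h
      · omega
      · omega
      · exact (hM x y hxy hx hy).1
      · have := hM y x hxy.symm hy hx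
        omega
    obtain ⟨V, hV, hVN⟩ := exists_profile hp hadd hPN
    refine ⟨V, hV, (mem_copeland_iff hs V c).2 fun v => ?_⟩
    have hgoal : goal s n m c P ≤ points s n (support V) c := by
      rw [goal, ← ncard_eq_count]
      refine Set.ncard_le_ncard fun y hy => ?_
      have hyc : y ≠ c := fun e => hy.1 (congrArg Fin.val e)
      refine ⟨hyc, ?_⟩
      have h1 := hVN c y hyc.symm
      have h2 := hy.2
      have h3 := hsum y c hyc
      simp only [N, if_true] at h1
      omega
    by_cases hvc : v = c
    · rw [hvc]
    · refine le_trans ?_ ((hG v v.2).trans hgoal)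
      rw [← ncard_eq_count]
      refine Set.ncard_le_ncard fun z hz => ?_
      obtain ⟨hzv, hpt⟩ := hz
      rw [hVN v z hzv.symm] at hpt
      have h0 := hsum v z hzv.symm
      have hv' : (v : ℕ) ≠ c := fun e => hvc (Fin.ext e)
      have hvz' : (v : ℕ) ≠ z := fun e => hzv (Fin.ext e.symm)
      by_cases hzc : z = c
      · simp only [N, if_neg hvc, if_pos hzc] at hpt
        exact hF v v.2 z z.2 ⟨hv', hvz', hpt⟩
      · have hz' : (z : ℕ) ≠ c := fun e => hzc (Fin.ext e)
        by_cases hfv : Forced s n c P v z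
        · exact hF v v.2 z z.2 hfv
        have h1 : 2 * P v z + s ≤ n := by
          by_contra! h; exact hfv ⟨hv', hvz', h⟩
        by_cases hfz : Forced s n c P z v
        · simp only [N, if_neg hvc, if_neg hzc, M, if_neg hfv, if_pos hfz] at hpt
          split_ifs at hpt <;> omega
        have h2 : 2 * P z v + s ≤ n := by
          by_contra! h; exact hfz ⟨hz', hvz'.symm, h⟩
        by_cases hev : s = 0 ∧ 2 * (n / 2) = n
        · simp only [N, if_neg hvc, if_neg hzc, M, if_neg hfv, if_neg hfz, if_pos hev] at hpt
          split_ifs at hpt <;> omega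
        have hd : Disputed s n c P v z := ⟨hv', hz', hvz', h1, h2, hev⟩
        simp only [N, if_neg hvc, if_neg hzc, M, if_neg hfv, if_neg hfz, if_neg hev] at hpt
        by_contra hnG
        have hzG := (hU v v.2 z z.2 hd).resolve_left hnG
        simp only [Set.mem_ofPred_eq] at hnG
        rw [if_neg hnG, if_pos hzG] at hpt
        split_ifs at hpt <;> omega

end

/-! ### The decision procedure -/

/-- The matrices `A i`, `i < n`, describe partial orders on `m` candidates with at most one
undetermined pair. -/
def Admissible (m n : ℕ) (A : ℕ → ℕ → ℕ → Prop) : Prop :=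
  ∀ i < n, (∀ x < m, A i x x) ∧ (∀ x < m, ∀ y < m, A i x y ∧ A i y x → x = y) ∧
    (∀ x < m, ∀ y < m, ∀ z < m, A i x y ∧ A i y z → A i x z) ∧
    ∀ x < m, ∀ y < m, ∀ x' < m, ∀ y' < m, (x < y ∧ ¬ A i x y ∧ ¬ A i y x) ∧
      (x' < y' ∧ ¬ A i x' y' ∧ ¬ A i y' x') → x = x' ∧ y = y'

/-- The outcome of the fictitious play shows that `c` can win. -/
def Winnable (s m n c : ℕ) (A : ℕ → ℕ → ℕ → Prop) : Prop :=
  ∀ v < m, m * play m (Forced s n c fun x y => count n fun i => A i x y)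
      (Disputed s n c fun x y => count n fun i => A i x y) (m ^ 5 + 1) v <
    m ^ 5 + 1 + m * (m ^ 5 + 1) * goal s n m c fun x y => count n fun i => A i x y

/-- The entries of `A` are those of the matrices of the partial votes. -/
def PWInstance.Matches (I : PWInstance) (A : ℕ → ℕ → ℕ → Prop) : Prop :=
  ∀ (i : Fin I.n) (x y : Fin I.m), A i x y ↔ (I.votes i).pref x y

theorem PWInstance.isYes_iff {I : PWInstance} {A : ℕ → ℕ → ℕ → Prop} (hA : I.Matches A) {s : ℕ}
    (hs : s ≤ 1) (hI : ∀ i, (I.votes i).numUndetermined ≤ 1) :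
    I.IsYes (copeland s) ↔ Winnable s I.m I.n I.c A := by
  refine (exists_winning_extension_iff hs hI I.c (P := fun x y => count I.n fun i => A i x y)
    fun x y => ?_).trans (distributable_iff (fun _ _ => not_forced_of_disputed)
    (fun _ _ => disputed_symm) (fun _ _ h => h.2.2.1) (goal_le _ _ _ _ _) (Nat.lt_succ_self _))
  rw [← ncard_eq_count, fixedSupport]
  simp only [hA _ x y]

theorem PWInstance.admissible {I : PWInstance} {A : ℕ → ℕ → ℕ → Prop} (hA : I.Matches A)
    (hI : ∀ i, (I.votes i).numUndetermined ≤ 1) : Admissible I.m I.n A := by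
  intro i hi
  have hA' : ∀ x (hx : x < I.m) y (hy : y < I.m),
      A i x y ↔ (I.votes ⟨i, hi⟩).pref ⟨x, hx⟩ ⟨y, hy⟩ := fun x hx y hy => hA ⟨i, hi⟩ ⟨x, hx⟩ ⟨y, hy⟩
  have hp := (I.votes ⟨i, hi⟩).isPartialOrder
  refine ⟨fun x hx => (hA' x hx x hx).2 (hp.refl _), fun x hx y hy h => ?_,
    fun x hx y hy z hz h => ?_, fun x hx y hy x' hx' y' hy' h => ?_⟩
  · rw [hA' x hx y hy, hA' y hy x hx] at h
    exact congrArg Fin.val (hp.antisymm _ _ h.1 h.2)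
  · rw [hA' x hx y hy, hA' y hy z hz] at h
    exact (hA' x hx z hz).2 (hp.trans _ _ _ h.1 h.2)
  · rw [hA' x hx y hy, hA' y hy x hx, hA' x' hx' y' hy', hA' y' hy' x' hx'] at h
    rcases PartialVote.undetermined_unique (hI ⟨i, hi⟩) h.1.2.1 h.1.2.2 h.2.2.1 h.2.2.2 with
      h' | h' <;> simp only [Fin.mk.injEq] at h' <;> omega

/-- The instance that is described by admissible matrices. -/
def instanceOf {m n c : ℕ} {A : ℕ → ℕ → ℕ → Prop} (h : Admissible m n A) (hn : 0 < n)
    (hc : c < m) : PWInstance where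
  m := m
  n := n
  n_pos := hn
  c := ⟨c, hc⟩
  votes i := ⟨fun x y => A i x y,
    { refl := fun x => (h i i.2).1 x x.2
      trans := fun x y z h1 h2 => (h i i.2).2.2.1 x x.2 y y.2 z z.2 ⟨h1, h2⟩
      antisymm := fun x y h1 h2 => Fin.ext ((h i i.2).2.1 x x.2 y y.2 ⟨h1, h2⟩) }⟩

theorem instanceOf_numUndetermined {m n c : ℕ} {A : ℕ → ℕ → ℕ → Prop} (h : Admissible m n A)
    (hn : 0 < n) (hc : c < m) (i : Fin n) :
    ((instanceOf h hn hc).votes i).numUndetermined ≤ 1 := by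
  refine (Set.ncard_le_one_iff (Set.toFinite _)).2 fun {a b} ha hb => ?_
  have := (h i i.2).2.2.2 a.1 a.1.2 a.2 a.2.2 b.1 b.1.2 b.2 b.2.2 ⟨ha, hb⟩
  exact Prod.ext (Fin.ext this.1) (Fin.ext this.2)

/-! ### Reading the input -/

/-- The length of the first block of ones. -/
def lead (w : List Bool) : ℕ := (w.takeWhile id).length

/-- What follows the first block of ones and the zero that ends it. -/
def rest (w : List Bool) : List Bool := (w.dropWhile id).tail

theorem lead_append (k : ℕ) (r : List Bool) : lead (List.replicate k true ++ false :: r) = k := by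
  induction k with
  | zero => rfl
  | succ k ih => simp_all [lead, List.replicate_succ]

theorem rest_append (k : ℕ) (r : List Bool) : rest (List.replicate k true ++ false :: r) = r := by
  induction k with
  | zero => rfl
  | succ k ih => simp_all [rest, List.replicate_succ]

theorem eq_append_of_rest_ne_nil {w : List Bool} (h : rest w ≠ []) :
    w = List.replicate (lead w) true ++ false :: rest w := by
  induction w with
  | nil => exact absurd rfl h
  | cons b w ih =>
    cases b
    · rfl
    · have := ih h
      simp only [lead, rest, List.takeWhile_cons, List.dropWhile_cons, id, if_true,
        List.length_cons, List.replicate_succ, List.cons_append] at this ⊢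
      exact congrArg _ this

/-! ### Indexing in concatenations of blocks of equal length -/

section
variable {α β : Type} {f : α → List β} {k : ℕ}

theorem length_flatMap_of_length_eq (hk : ∀ a, (f a).length = k) (l : List α) :
    (l.flatMap f).length = l.length * k := by
  simp [List.length_flatMap, hk]

theorem getD_flatMap_of_length_eq (hk : ∀ a, (f a).length = k) (l : List α) (d : β) {i j : ℕ}
    (hi : i < l.length) (hj : j < k) :
    (l.flatMap f).getD (i * k + j) d = (f l[i]).getD j d := by
  induction l generalizing i with
  | nil => simp at hi
  | cons a l ih =>
    rw [List.flatMap_cons]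
    cases i with
    | zero => rw [List.getD_append _ _ _ _ (by rw [hk]; omega)]; simp
    | succ i =>
      rw [List.getD_append_right _ _ _ _ (by rw [hk, add_mul]; omega), hk,
        show (i + 1) * k + j - k = i * k + j by rw [add_mul]; omega, ih (by simpa using hi)]
      simp

end

/-- The matrices that a string consists of. -/
def entry (R : List Bool) (m i x y : ℕ) : Prop := R.getD (i * (m * m) + (x * m + y)) false = true

open Classical in
/-- The matrices in the encoding of an instance. -/
noncomputable def PWInstance.body (I : PWInstance) : List Bool :=
  (List.finRange I.n).flatMap fun i => (List.finRange I.m).flatMap fun x =>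
    (List.finRange I.m).map fun y => decide ((I.votes i).pref x y)

theorem PWInstance.encode_eq (I : PWInstance) : I.encode =
    List.replicate I.m true ++ false :: (List.replicate I.c true ++ false :: I.body) := rfl

theorem PWInstance.length_body (I : PWInstance) : I.body.length = I.n * (I.m * I.m) := by
  rw [body, length_flatMap_of_length_eq (k := I.m * I.m), List.length_finRange]
  intro i
  rw [length_flatMap_of_length_eq (k := I.m)] <;> simp

theorem index_lt {a b m k : ℕ} (ha : a < k) (hb : b < m) : a * m + b < k * m := by
  nlinarith

theorem PWInstance.matches_body (I : PWInstance) : I.Matches (entry I.body I.m) := by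
  classical
  intro i x y
  rw [entry, body, getD_flatMap_of_length_eq (k := I.m * I.m) _ _ _ (by simp) (index_lt x.2 y.2),
    getD_flatMap_of_length_eq (k := I.m) _ _ _ (by simp) y.2]
  · simp [List.getD_eq_getElem?_getD]
  · simp
  · intro i
    rw [length_flatMap_of_length_eq (k := I.m)] <;> simp

/-- Division with remainder by m² and then by m writes every position as i m² + x m + y within the
bounds, so the entries exhaust the string. -/
theorem eq_of_entry {R R' : List Bool} {n m : ℕ} (hR : R.length = n * (m * m))
    (hR' : R'.length = n * (m * m))
    (h : ∀ i < n, ∀ x < m, ∀ y < m, entry R m i x y ↔ entry R' m i x y) : R = R' := by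
  refine List.ext_getElem (hR.trans hR'.symm) fun q h1 h2 => ?_
  rw [hR] at h1
  have hm : 0 < m := Nat.pos_of_ne_zero fun e => by simp [e] at h1
  have h3 := h (q / (m * m)) ((Nat.div_lt_iff_lt_mul (by positivity)).2 h1) (q % (m * m) / m)
    ((Nat.div_lt_iff_lt_mul hm).2 (Nat.mod_lt _ (by positivity))) (q % (m * m) % m)
    (Nat.mod_lt _ hm)
  rw [entry, entry, mul_comm (q % (m * m) / m), Nat.div_add_mod, mul_comm (q / (m * m)),
    Nat.div_add_mod, List.getD_eq_getElem _ _ (hR ▸ h1), List.getD_eq_getElem _ _ h2] at h3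
  exact Bool.eq_iff_iff.2 h3

/-- The number of blocks of length `k` that fit into the length `l`. -/
noncomputable def numBlocks (l k : ℕ) : ℕ := count l fun j => (j + 1) * k ≤ l

/-- Division is expressed by counting so that `PT.count` makes it polynomial time. -/
theorem numBlocks_mul {n k : ℕ} (hk : 0 < k) : numBlocks (n * k) k = n := by
  classical
  have : (Finset.range (n * k)).filter (fun j => (j + 1) * k ≤ n * k) = Finset.range n := by
    ext j
    simp only [Finset.mem_filter, Finset.mem_range, Nat.mul_le_mul_right_iff hk]
    exact ⟨fun h => h.2, fun h => ⟨h.trans_le (Nat.le_mul_of_pos_right n hk), h⟩⟩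
  rw [numBlocks, count]
  convert congrArg Finset.card this
  simp

/-- The description of the language by the parts of the input. -/
def Accepts (s m n c : ℕ) (R : List Bool) : Prop :=
  (c < m ∧ 0 < n ∧ n * (m * m) = R.length) ∧ Admissible m n (entry R m) ∧
    Winnable s m n c (entry R m)

/-- The number of votes in the input. -/
noncomputable def voteCount (w : List Bool) : ℕ :=
  numBlocks (rest (rest w)).length (lead w * lead w)

theorem mem_possibleWinner_iff {s : ℕ} (hs : s ≤ 1) (w : List Bool) :
    w ∈ possibleWinner (copeland s) 1 ↔
      Accepts s (lead w) (voteCount w) (lead (rest w)) (rest (rest w)) := by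
  constructor
  · rintro ⟨I, rfl, hI, hyes⟩
    have hm : 0 < I.m := I.c.pos
    rw [voteCount, I.encode_eq, rest_append, rest_append, lead_append, lead_append, I.length_body,
      numBlocks_mul (by positivity)]
    exact ⟨⟨I.c.2, I.n_pos, I.length_body.symm⟩, I.admissible I.matches_body hI,
      (I.isYes_iff I.matches_body hs hI).1 hyes⟩
  · rintro ⟨⟨hc, hn, hlen⟩, hadm, hwin⟩
    have hI := instanceOf_numUndetermined hadm hn hc
    refine ⟨instanceOf hadm hn hc, ?_, hI,
      (PWInstance.isYes_iff (A := entry (rest (rest w)) (lead w)) (fun _ _ _ => Iff.rfl) hs hI).2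
        hwin⟩
    have hbody : (instanceOf hadm hn hc).body = rest (rest w) :=
      eq_of_entry (n := voteCount w) (m := lead w) (PWInstance.length_body _) hlen.symm
        fun i hi x hx y hy =>
          (instanceOf hadm hn hc).matches_body ⟨i, hi⟩ ⟨x, hx⟩ ⟨y, hy⟩
    -- A nonempty remainder guarantees that the separating zeros are really present; `lead` and
    -- `rest` alone would not detect a missing one.
    have hne2 : rest (rest w) ≠ [] := by
      rw [← List.length_pos_iff, ← hlen]
      have : 0 < lead w := by omega
      positivity
    have hne1 : rest w ≠ [] := fun e => hne2 (by rw [e]; rfl)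
    rw [PWInstance.encode_eq, hbody]
    change List.replicate (lead w) true ++ false ::
      (List.replicate (lead (rest w)) true ++ false :: rest (rest w)) = w
    rw [← eq_append_of_rest_ne_nil hne2, ← eq_append_of_rest_ne_nil hne1]

/-! ### The decision procedure runs in polynomial time -/

section
variable {α : Type} [Enc α]

/-- The step is idle once the head is not `true`, so the length of `w` is a sufficient number of
rounds. -/
theorem takeWhile_iterate (w : List Bool) (k : ℕ) {j : ℕ} (hj : w.length ≤ j) :
    (fun p : List Bool × ℕ => bif p.1.headD false then (p.1.tail, p.2 + 1) else p)^[j] (w, k) =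
      (w.dropWhile id, k + lead w) := by
  have hfix : ∀ (p : List Bool × ℕ), p.1.headD false = false → ∀ j,
      (fun p : List Bool × ℕ => bif p.1.headD false then (p.1.tail, p.2 + 1) else p)^[j] p = p :=
    fun p hp j => Function.iterate_fixed (by simp only [hp, cond_false]) j
  induction w generalizing k j with
  | nil => exact hfix _ rfl j
  | cons b w ih =>
    cases b
    · exact hfix _ rfl j
    · obtain ⟨j, rfl⟩ := Nat.exists_eq_succ_of_ne_zero (n := j) (by simp at hj; omega)
      rw [Function.iterate_succ_apply]
      refine (ih (k + 1) (by simpa using hj)).trans ?_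
      simp [lead]; omega

theorem PolyTime.PT.takeWhile {f : α → List Bool} (hf : PT f) :
    PT fun a => ((f a).dropWhile _root_.id, _root_.lead (f a)) := by
  have hstep : PT fun p : List Bool × ℕ => bif p.1.headD false then (p.1.tail, p.2 + 1) else p :=
    PT.cond (PT.headD rfl (by fun_prop)) (by fun_prop) (by fun_prop)
  -- Removing a `true` saves 4 bits of code, incrementing the unary counter costs 2.
  have hbd : ∀ j (p : List Bool × ℕ), size ((fun p : List Bool × ℕ =>
      bif p.1.headD false then (p.1.tail, p.2 + 1) else p)^[j] p) ≤ size p := by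
    intro j
    induction j with
    | zero => exact fun p => le_rfl
    | succ j ih =>
      intro p
      rw [Function.iterate_succ_apply]
      refine (ih _).trans ?_
      obtain ⟨l, k⟩ := p
      rcases l with _ | ⟨_ | _, l⟩
      · exact le_rfl
      · exact le_rfl
      · have : size true = 3 := rfl
        simp only [List.headD_cons, cond_true, List.tail_cons, size_pair, size_cons, size_nat]
        omega
  have h := PT.iterate (s := fun a => (f a, 0)) hf (by fun_prop) hstep
    (b := fun a => size (f a) + 1 + 1) ((hf.bdd.add (.const 1)).add (.const 1))
    fun a i _ => (hbd i _).trans (by rw [size_pair, size_nat]; exact le_rfl)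
  convert h using 2 with a
  rw [takeWhile_iterate _ _ (by rw [spine_list]), zero_add]

@[fun_prop]
theorem PolyTime.PT.lead {f : α → List Bool} (hf : PT f) : PT fun a => lead (f a) :=
  hf.takeWhile.snd

@[fun_prop]
theorem PolyTime.PT.rest {f : α → List Bool} (hf : PT f) : PT fun a => rest (f a) :=
  hf.takeWhile.fst.tail

@[fun_prop]
theorem PolyTime.PT.entry {R : α → List Bool} {m i x y : α → ℕ} (hR : PT R) (hm : PT m) (hi : PT i)
    (hx : PT x) (hy : PT y) : PT fun a => entry (R a) (m a) (i a) (x a) (y a) := by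
  unfold _root_.entry
  fun_prop

@[fun_prop]
theorem PolyTime.PT.numBlocks {l k : α → ℕ} (hl : PT l) (hk : PT k) :
    PT fun a => numBlocks (l a) (k a) :=
  PT.count hl (by fun_prop)

@[fun_prop]
theorem PolyTime.PT.voteCount {f : α → List Bool} (hf : PT f) : PT fun a => voteCount (f a) := by
  unfold _root_.voteCount
  fun_prop

theorem PolyTime.PT.admissible {m n : α → ℕ} {A : α → ℕ → ℕ → ℕ → Prop} (hm : PT m) (hn : PT n)
    (hA : PT fun p : α × ℕ × ℕ × ℕ => A p.1 p.2.1 p.2.2.1 p.2.2.2) :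
    PT fun a => Admissible (m a) (n a) (A a) := by
  have hA' : ∀ {β : Type} [Enc β] {a : β → α} {i x y : β → ℕ}, PT a → PT i → PT x → PT y →
      PT fun b => A (a b) (i b) (x b) (y b) := fun ha hi hx hy =>
    PT.comp hA (ha.pair (hi.pair (hx.pair hy)))
  refine PT.ball hn (PT.and ?_ (PT.and ?_ (PT.and ?_ ?_)))
  · exact PT.ball (by fun_prop) (hA' (by fun_prop) (by fun_prop) (by fun_prop) (by fun_prop))
  · refine PT.ball (by fun_prop) (PT.ball (by fun_prop) (PT.imp (PT.and ?_ ?_) (by fun_prop)))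
    all_goals exact hA' (by fun_prop) (by fun_prop) (by fun_prop) (by fun_prop)
  · refine PT.ball (by fun_prop) (PT.ball (by fun_prop) (PT.ball (by fun_prop)
      (PT.imp (PT.and ?_ ?_) ?_)))
    all_goals exact hA' (by fun_prop) (by fun_prop) (by fun_prop) (by fun_prop)
  · refine PT.ball (by fun_prop) (PT.ball (by fun_prop) (PT.ball (by fun_prop)
      (PT.ball (by fun_prop) (PT.imp (PT.and (PT.and (by fun_prop) (PT.and (PT.not ?_) (PT.not ?_)))
      (PT.and (by fun_prop) (PT.and (PT.not ?_) (PT.not ?_)))) (by fun_prop)))))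
    all_goals exact hA' (by fun_prop) (by fun_prop) (by fun_prop) (by fun_prop)

/-- The recursion runs on the table of all totals, since a round needs the totals of all vertices.
They are at most T m, so even in unary the table stays of polynomial size. -/
theorem PolyTime.PT.play {m T : α → ℕ} {F U : α → ℕ → ℕ → Prop} (hm : PT m) (hT : PT T)
    (hF : PT fun p : α × ℕ × ℕ => F p.1 p.2.1 p.2.2)
    (hU : PT fun p : α × ℕ × ℕ => U p.1 p.2.1 p.2.2) :
    PT fun a => (List.range (m a)).map (play (m a) (F a) (U a) (T a)) := by
  have hF' : ∀ {β : Type} [Enc β] {a : β → α} {x y : β → ℕ}, PT a → PT x → PT y →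
      PT fun b => F (a b) (x b) (y b) := fun ha hx hy => PT.comp hF (ha.pair (hx.pair hy))
  have hU' : ∀ {β : Type} [Enc β] {a : β → α} {x y : β → ℕ}, PT a → PT x → PT y →
      PT fun b => U (a b) (x b) (y b) := fun ha hx hy => PT.comp hU (ha.pair (hx.pair hy))
  refine PT.rec (F := fun a t => (List.range (m a)).map (_root_.play (m a) (F a) (U a) t))
    (s := fun a _ r => (List.range (m a)).map fun v => r.getD v 0 +
      PolyTime.count (m a) (Gains (F a) (U a) (fun v => r.getD v 0) v)) hT ?_ ?_ ?_
    (b := fun a => m a * (2 * (T a * m a) + 1 + 1) + 1) ?_ ?_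
  · exact PT.table hm (.const 0)
  · refine PT.table (by fun_prop) (PT.add (by fun_prop) (PT.count (by fun_prop) (PT.or ?_
      (PT.and ?_ ?_))))
    · exact hF' (by fun_prop) (by fun_prop) (by fun_prop)
    · exact hU' (by fun_prop) (by fun_prop) (by fun_prop)
    · unfold Prefers
      fun_prop
  · intro a i _
    refine List.map_congr_left fun v hv => ?_
    have hget : ∀ v < m a, ((List.range (m a)).map
        (_root_.play (m a) (F a) (U a) i)).getD v 0 = _root_.play (m a) (F a) (U a) i v :=
      fun v hv => by simp [List.getD_eq_getElem?_getD, hv]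
    rw [List.mem_range] at hv
    simp only [hget v hv, _root_.play]
    congr 1
    refine le_antisymm (count_mono fun z hz h => ?_) (count_mono fun z hz h => ?_)
    all_goals simpa only [Gains, Prefers, hget v hv, hget z hz] using h
  · have hm' := PolyBdd.val hm
    exact (hm'.mul ((((PolyBdd.const 2).mul ((PolyBdd.val hT).mul hm')).add (.const 1)).add
      (.const 1))).add (.const 1)
  · intro a i hi
    refine (size_list_le (b := 2 * (T a * m a) + 1) fun x hx => ?_).trans (by simp)
    obtain ⟨v, -, rfl⟩ := List.mem_map.1 hx
    have h1 := play_le (m a) (F a) (U a) i v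
    have h2 := Nat.mul_le_mul_right (m a) hi
    rw [size_nat]; omega

theorem PolyTime.PT.winnable {s : ℕ} {m n c : α → ℕ} {A : α → ℕ → ℕ → ℕ → Prop} (hm : PT m)
    (hn : PT n) (hc : PT c) (hA : PT fun p : α × ℕ × ℕ × ℕ => A p.1 p.2.1 p.2.2.1 p.2.2.2) :
    PT fun a => Winnable s (m a) (n a) (c a) (A a) := by
  have hP : ∀ {β : Type} [Enc β] {a : β → α} {x y : β → ℕ}, PT a → PT x → PT y →
      PT fun b => PolyTime.count (n (a b)) fun i => A (a b) i (x b) (y b) := fun ha hx hy =>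
    PT.count (by fun_prop) (PT.comp hA (by fun_prop : PT fun p => (_, _, _, _)))
  have hhalf : PT fun a => 2 * (n a / 2) = n a := by
    -- Both equations say that n is even; `numBlocks` takes the place of the division.
    refine PT.of_iff (P := fun a => 2 * _root_.numBlocks (n a) 2 = n a) (by fun_prop) fun a => ?_
    constructor
    · intro h; omega
    · intro h
      have := numBlocks_mul (n := n a / 2) (k := 2) (by norm_num)
      rw [mul_comm, h] at this
      omega
  have hF : PT fun p : α × ℕ × ℕ => Forced s (n p.1) (c p.1)
      (fun x y => PolyTime.count (n p.1) fun i => A p.1 i x y) p.2.1 p.2.2 := by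
    have := hP (a := fun p : α × ℕ × ℕ => p.1) (x := fun p => p.2.1) (y := fun p => p.2.2)
      (by fun_prop) (by fun_prop) (by fun_prop)
    unfold Forced
    fun_prop
  have hU : PT fun p : α × ℕ × ℕ => Disputed s (n p.1) (c p.1)
      (fun x y => PolyTime.count (n p.1) fun i => A p.1 i x y) p.2.1 p.2.2 := by
    have h1 := hP (a := fun p : α × ℕ × ℕ => p.1) (x := fun p => p.2.1) (y := fun p => p.2.2)
      (by fun_prop) (by fun_prop) (by fun_prop)
    have h2 := hP (a := fun p : α × ℕ × ℕ => p.1) (x := fun p => p.2.2) (y := fun p => p.2.1)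
      (by fun_prop) (by fun_prop) (by fun_prop)
    have h3 : PT fun p : α × ℕ × ℕ => 2 * (n p.1 / 2) = n p.1 := PT.comp hhalf (by fun_prop)
    unfold Disputed
    fun_prop
  have hG : PT fun a => goal s (n a) (m a) (c a)
      fun x y => PolyTime.count (n a) fun i => A a i x y := by
    refine PT.count hm (PT.and (by fun_prop) (PT.lt (PT.mul (by fun_prop) ?_) (by fun_prop)))
    exact hP (by fun_prop) (by fun_prop) (by fun_prop)
  have hT : PT fun a => m a ^ 5 + 1 := by
    simp only [pow_succ, pow_zero]
    fun_prop
  have hplay := PT.play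
    (F := fun a => Forced s (n a) (c a) fun x y => PolyTime.count (n a) fun i => A a i x y)
    (U := fun a => Disputed s (n a) (c a) fun x y => PolyTime.count (n a) fun i => A a i x y)
    hm hT hF hU
  refine PT.of_iff (P := fun a => ∀ v < m a, m a * ((List.range (m a)).map (_root_.play (m a)
      (Forced s (n a) (c a) fun x y => PolyTime.count (n a) fun i => A a i x y)
      (Disputed s (n a) (c a) fun x y => PolyTime.count (n a) fun i => A a i x y)
      (m a ^ 5 + 1))).getD v 0 < m a ^ 5 + 1 + m a * (m a ^ 5 + 1) * goal s (n a) (m a) (c a)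
        fun x y => PolyTime.count (n a) fun i => A a i x y) (PT.ball hm ?_) fun a => ?_
  · have hfst : PT fun p : α × ℕ => p.1 := by fun_prop
    have hT' := PT.comp hT hfst
    have hG' := PT.comp hG hfst
    have hplay' := PT.comp hplay hfst
    exact PT.lt (PT.mul (by fun_prop) (PT.getD_nat hplay' (by fun_prop)))
      (PT.add hT' (PT.mul (PT.mul (by fun_prop) hT') hG'))
  · refine forall₂_congr fun v hv => ?_
    simp [List.getD_eq_getElem?_getD, hv]

end

/-! ### Membership in P -/

theorem inP_possibleWinner {s : ℕ} (hs : s ≤ 1) : InP (possibleWinner (copeland s) 1) := by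
  refine inP_of_pt (PT.of_iff (P := fun w => Accepts s (lead w) (voteCount w) (lead (rest w))
    (rest (rest w))) ?_ fun w => (mem_possibleWinner_iff hs w).symm)
  have hA : PT fun p : List Bool × ℕ × ℕ × ℕ =>
      entry (rest (rest p.1)) (lead p.1) p.2.1 p.2.2.1 p.2.2.2 := by fun_prop
  exact PT.and (by fun_prop) (PT.and (PT.admissible (by fun_prop) (by fun_prop) hA)
    (PT.winnable (by fun_prop) (by fun_prop) (by fun_prop) hA))

theorem mainTheorem6 :
    InP (possibleWinner (copeland 0) 1) ∧ InP (possibleWinner (copeland 1) 1) := by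
  have h0 := inP_possibleWinner (s := 0) (by norm_num)
  have h1 := inP_possibleWinner (s := 1) le_rfl
  rw [Nat.cast_zero] at h0
  rw [Nat.cast_one] at h1
  exact ⟨h0, h1⟩
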